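/- A 2-colored graph is a simple graph $G$ with a map $V(G)\to\{\text{red},\text{blue}\}$ (adjacent vertices may have the same color); induced subgraphs inherit colors and isomorphisms preserve colors. $G$ is ultrahomogeneous if every isomorphism between finite induced subgraphs of $G$ extends to an automorphism of $G$. $G$ is a blow-up if, for some $i\in\{2,3,\dots\}\cup\{\aleph_0\}$, it is isomorphic to a graph obtained from a 2-colored graph $H$ in which one color class is a nonempty independent set by replacing every vertex of this class by a clique of size $i$ of the same color, whose members are joined to exactly the neighbors in $H$ of the replaced vertex. If the color classes of $G$ induce disjoint unions of cliques, then $G$ is called piecewise ultrahomogeneous if for every inclusion-wise maximal red clique $M$ and every inclusion-wise maximal blue clique $N$ of $G$, the subgraph induced by $M\cup N$ is ultrahomogeneous. For a 2-colored graph $H$, let $\widetilde H$ be obtained from $H$ by complementing the edges between vertices of different colors and keeping all other edges and non-edges. Let $D$ be the complete graph on two red and two blue vertices with one edge between a red and a blue vertex deleted. Let $T_r$ (resp. $T_b$) be the triangle with exactly one blue (resp. exactly one red) vertex. Let $F_{2,2}$ be the Fraïssé limit of the class of all finite 2-colored graphs whose color classes induce disjoint unions of cliques and which have no induced subgraph isomorphic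 to a monochromatic triangle, $T_r$, $\widetilde T_r$, $T_b$ or $\widetilde T_b$; that is, the (up to isomorphism unique) countable ultrahomogeneous 2-colored graph whose finite induced subgraphs are, up to isomorphism, exactly the graphs in this class. **Theorem A.** Let $G$ be a countably infinite, non-bipartite, ultrahomogeneous 2-colored graph whose color classes induce disjoint unions of cliques. Assume that $G$ is not a blow-up and that the two color classes of $G$ are not both cliques. If $G\not\cong F_{2,2}$, then $G$ is piecewise ultrahomogeneous if and only if $G$ contains induced subgraphs isomorphic to $D$ and to $\widetilde D$. If $G\cong F_{2,2}$, then $G$ is piecewise ultrahomogeneous, but contains neither $D$ nor $\widetilde D$ as an induced subgraph. -/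

import Mathlib

/-- The two colours. -/
inductive Color where
  | red
  | blue

/-- A simple graph with an arbitrary (not necessarily proper) vertex colouring by two colours. -/
structure TwoColoredGraph (V : Type*) where
  graph : SimpleGraph V
  color : V → Color

namespace TwoColoredGraph

universe u v w

/-- The set of vertices of colour `c`. -/
def colorClass {V : Type u} (G : TwoColoredGraph V) (c : Color) : Set V :=
  {x | G.color x = c}

/-- The induced subgraph on `s`, whose vertices inherit their colours. -/
def induce {V : Type u} (G : TwoColoredGraph V) (s : Set V) : TwoColoredGraph s where
  graph := G.graph.induce s
  color := fun x => G.color x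

/-- Colour-preserving graph isomorphisms. -/
structure Iso {V : Type u} {W : Type v} (G : TwoColoredGraph V) (H : TwoColoredGraph W) where
  toIso : G.graph ≃g H.graph
  map_color : ∀ x, H.color (toIso x) = G.color x

/-- `H` is realized in `G`: it is isomorphic to an induced subgraph of `G`. -/
def Realizes {V : Type u} {W : Type v} (G : TwoColoredGraph V) (H : TwoColoredGraph W) : Prop :=
  ∃ s : Set V, Nonempty (Iso H (G.induce s))

/-- Every isomorphism between finite induced subgraphs extends to an automorphism. -/
def Ultrahomogeneous {V : Type u} (G : TwoColoredGraph V) : Prop :=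
  ∀ s t : Set V, s.Finite → t.Finite → ∀ f : Iso (G.induce s) (G.induce t),
    ∃ g : Iso G G, ∀ x : s, g.toIso x = f.toIso x

/-- Complement the edges between the colour classes, keep those inside the colour classes. -/
def crossCompl {V : Type u} (G : TwoColoredGraph V) : TwoColoredGraph V where
  graph :=
    { Adj := fun x y =>
        (G.color x = G.color y ∧ G.graph.Adj x y) ∨ (G.color x ≠ G.color y ∧ ¬ G.graph.Adj x y)
      symm := ⟨fun x y h => by
        rcases h with ⟨h1, h2⟩ | ⟨h1, h2⟩
        · exact Or.inl ⟨h1.symm, h2.symm⟩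
        · exact Or.inr ⟨h1.symm, fun h => h2 h.symm⟩⟩
      loopless := ⟨fun x h => by
        rcases h with ⟨_, h2⟩ | ⟨h1, _⟩
        · exact G.graph.irrefl h2
        · exact h1 rfl⟩ }
  color := G.color

/-- The subgraph induced by the colour class `c` is a disjoint union of cliques: being equal or
adjacent is transitive on it. -/
def IsCliqueUnion {V : Type u} (G : TwoColoredGraph V) (c : Color) : Prop :=
  ∀ x ∈ G.colorClass c, ∀ y ∈ G.colorClass c, ∀ z ∈ G.colorClass c,
    G.graph.Adj x y → G.graph.Adj y z → x ≠ z → G.graph.Adj x z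

/-- `M` is an inclusion-wise maximal clique of the subgraph induced by the colour class `c`. -/
def IsMaximalClique {V : Type u} (G : TwoColoredGraph V) (c : Color) (M : Set V) : Prop :=
  Maximal (fun s : Set V => s ⊆ G.colorClass c ∧ G.graph.IsClique s) M

/-- Each subgraph induced by a maximal red clique and a maximal blue clique is
ultrahomogeneous. -/
def PiecewiseUltrahomogeneous {V : Type u} (G : TwoColoredGraph V) : Prop :=
  ∀ M N : Set V, G.IsMaximalClique Color.red M → G.IsMaximalClique Color.blue N →
    (G.induce (M ∪ N)).Ultrahomogeneous

/-- The vertices after replacing each vertex of colour `c` by a copy of `ι`. -/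
abbrev BlowUpVertex {W : Type u} (H : TwoColoredGraph W) (c : Color) (ι : Type v) :=
  (H.colorClass c × ι) ⊕ {x : W // x ∉ H.colorClass c}

/-- The original vertex of which a vertex of the blow-up is a copy. -/
def BlowUpVertex.base {W : Type u} {H : TwoColoredGraph W} {c : Color} {ι : Type v} :
    BlowUpVertex H c ι → W
  | Sum.inl p => p.1
  | Sum.inr x => x

/-- Replace every vertex of colour `c` in `H` by a clique indexed by `ι`, whose members are joined
to the neighbours of the original vertex; the other vertices are kept. -/
def blowUp {W : Type u} (H : TwoColoredGraph W) (c : Color) (ι : Type v) :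
    TwoColoredGraph (BlowUpVertex H c ι) where
  graph :=
    { Adj := fun x y => H.graph.Adj x.base y.base ∨ (x.base = y.base ∧ x ≠ y)
      symm := ⟨fun x y h => by
        rcases h with h | ⟨h1, h2⟩
        · exact Or.inl h.symm
        · exact Or.inr ⟨h1.symm, h2.symm⟩⟩
      loopless := ⟨fun x h => by
        rcases h with h | ⟨_, h2⟩
        · exact H.graph.irrefl h
        · exact h2 rfl⟩ }
  color := fun x => H.color x.base

/-- `G` arises from a graph `H` in which some colour class is a (nonempty) independent set by
replacing the vertices of that class by cliques of one common size in `{2, 3, …, ℵ₀}`. -/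
def IsBlowUp {V : Type u} (G : TwoColoredGraph V) : Prop :=
  ∃ (W : Type u) (H : TwoColoredGraph W) (c : Color) (ι : Type),
    (H.colorClass c).Nonempty ∧ H.graph.IsIndepSet (H.colorClass c) ∧
      Countable ι ∧ Nontrivial ι ∧ Nonempty (Iso G (H.blowUp c ι))

/-- The complete graph on two red vertices `0, 1` and two blue vertices `2, 3` with the cross edge
`{1, 3}` deleted. -/
def diamond : TwoColoredGraph (Fin 4) where
  graph := (⊤ : SimpleGraph (Fin 4)).deleteEdges {s(1, 3)}
  color := ![Color.red, Color.red, Color.blue, Color.blue]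

/-- The monochromatic triangle. -/
def monoTriangle (c : Color) : TwoColoredGraph (Fin 3) where
  graph := ⊤
  color := fun _ => c

/-- The triangle with a single blue vertex. -/
def triangleRed : TwoColoredGraph (Fin 3) where
  graph := ⊤
  color := ![Color.red, Color.red, Color.blue]

/-- The triangle with a single red vertex. -/
def triangleBlue : TwoColoredGraph (Fin 3) where
  graph := ⊤
  color := ![Color.blue, Color.blue, Color.red]

/-- The class of graphs whose colour classes are disjoint unions of cliques and which omit the
monochromatic triangles, the two bichromatic triangles, and the cross-complements of the latter. -/
def MemClassF22 {W : Type u} (H : TwoColoredGraph W) : Prop :=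
  (∀ c, H.IsCliqueUnion c) ∧ (∀ c, ¬ H.Realizes (monoTriangle c)) ∧
    ¬ H.Realizes triangleRed ∧ ¬ H.Realizes triangleRed.crossCompl ∧
    ¬ H.Realizes triangleBlue ∧ ¬ H.Realizes triangleBlue.crossCompl

/-- `G` is (isomorphic to) `F_{2,2}`, the Fraïssé limit of the finite graphs in the class above:
the countable ultrahomogeneous graph whose finite induced subgraphs are, up to isomorphism,
precisely the finite members of that class. -/
def IsF22 {V : Type u} (G : TwoColoredGraph V) : Prop :=
  Countable V ∧ G.Ultrahomogeneous ∧
    ∀ (n : ℕ) (H : TwoColoredGraph (Fin n)), G.Realizes H ↔ H.MemClassF22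

end TwoColoredGraph

/-!
The argument works with the relation `Near`: two vertices are near if they have the same colour and
are equal or adjacent. Its classes are the maximal monochromatic cliques, and automorphisms
permute them. The basic tool is *transfer*: if the tuples `s` and `t` are isomorphic and `y` has
the same adjacencies to `s` as `y'` to `t`, then some automorphism maps `(s, y)` to `(t, y')`, hence
the clique of `y` to that of `y'`; so the adjacency types over `s` that occur in the clique of `y`
are those over `t` that occur in the clique of `y'`.

Suppose first that a colour class is independent. The graph is neither bipartite nor a blow-up, so
a vertex of this class splits a clique of the other colour, i.e. has neighbours and non-neighbours
in it (`Ultrahomogeneous.isBlowUp`). This contradicts piecewise ultrahomogeneity, and the diamond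
does not embed. Otherwise, since `G` is not a blow-up, transfer shows that every vertex splits every
clique of the other colour (`Ultrahomogeneous.splits`). Counting cross edges between two near
vertices of each colour, the diamond is a configuration with three of them and its cross-complement
one with a single one, and there are the following cases.

* Both configurations occur. Transfer yields all four adjacency types over every near pair in every
  clique of the other colour, and a counting argument shows that each type occurs infinitely often
  (`AllTypes.infinite_typeSet`). Let `s` and `t` be tuples in one clique `M`, let `N` be a clique
  of the other colour, and choose distinct `y, y₀ ∈ N`. There is a tuple `u` in `M` over which `y`
  has its type over `t`, and `y₀` has the type of `y` over `s`. Moving `(u, y)` to `(t, y)` moves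
  `y₀` to a vertex of `N` with the same type over `t` as `y` over `s`. So the map from `s` to `t`
  extends to an automorphism that preserves `M` and `N` (`AllTypes.piecewise`).
* Only one of them occurs. After complementing the cross edges, cliques of different colours are
  joined by perfect matchings, and then each colour class must be a single clique
  (`Ultrahomogeneous.near_of_not_hasThreeCross`), which is excluded.
* Neither occurs, so that the number of cross edges among two near pairs is always even. If `G` is
  piecewise ultrahomogeneous, then near vertices have complementary neighbourhoods in the other
  colour class (`PiecewiseUltrahomogeneous.adj_iff_not_adj`). Cliques then have two vertices, and
  interchanging them shows that all adjacency types over vertices of distinct cliques are realized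
  (`Complementary.exists_type`). So every finite graph of the defining class of `F_{2,2}` embeds.

Conversely, near vertices of `F_{2,2}` have complementary neighbourhoods, which excludes both
configurations and gives piecewise ultrahomogeneity.
-/

namespace TwoColoredGraph

universe u

variable {V W : Type*} {G : TwoColoredGraph V} {H : TwoColoredGraph W}

/-! ### Monochromatic cliques and automorphisms -/

/-- `x` and `y` lie in a common monochromatic clique: they have the same colour and are equal or
adjacent. -/
def Near (G : TwoColoredGraph V) (x y : V) : Prop :=
  G.color x = G.color y ∧ (x = y ∨ G.graph.Adj x y)

theorem Near.refl (x : V) : G.Near x x := ⟨rfl, Or.inl rfl⟩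

theorem Near.symm {x y : V} (h : G.Near x y) : G.Near y x :=
  ⟨h.1.symm, h.2.imp Eq.symm fun h => h.symm⟩

theorem Near.adj {x y : V} (h : G.Near x y) (hne : x ≠ y) : G.graph.Adj x y :=
  h.2.resolve_left hne

theorem Near.trans (hG : ∀ c, G.IsCliqueUnion c) {x y z : V} (hxy : G.Near x y)
    (hyz : G.Near y z) : G.Near x z := by
  refine ⟨hxy.1.trans hyz.1, ?_⟩
  by_cases hxz : x = z
  · exact Or.inl hxz
  rcases hxy with ⟨h1, rfl | h2⟩
  · exact hyz.2
  rcases hyz with ⟨h3, rfl | h4⟩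
  · exact Or.inr h2
  exact Or.inr (hG (G.color x) x rfl y h1.symm z (h3.symm.trans h1.symm) h2 h4 hxz)

theorem color_ne_iff {a b c : Color} (h : a ≠ b) : c ≠ a ↔ c = b := by
  cases a <;> cases b <;> cases c <;> simp_all

theorem Iso.adj_iff {H : TwoColoredGraph W} (φ : Iso G H) {x y : V} :
    H.graph.Adj (φ.toIso x) (φ.toIso y) ↔ G.graph.Adj x y := φ.toIso.map_adj_iff

theorem Iso.near_iff {H : TwoColoredGraph W} (φ : Iso G H) {x y : V} :
    H.Near (φ.toIso x) (φ.toIso y) ↔ G.Near x y := by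
  simp [Near, φ.map_color, φ.adj_iff]

theorem Iso.exists_preimage {H : TwoColoredGraph W} (φ : Iso G H) (y : W) :
    ∃ x, φ.toIso x = y := φ.toIso.surjective y

/-- Ultrahomogeneity for tuples: two finite tuples with the same colours, equalities and
adjacencies are related by an automorphism. -/
theorem Ultrahomogeneous.exists_iso (hG : G.Ultrahomogeneous) {ι : Type*} [Finite ι]
    (f g : ι → V) (hc : ∀ i, G.color (f i) = G.color (g i))
    (he : ∀ i j, f i = f j ↔ g i = g j)
    (ha : ∀ i j, G.graph.Adj (f i) (f j) ↔ G.graph.Adj (g i) (g j)) :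
    ∃ φ : Iso G G, ∀ i, φ.toIso (f i) = g i := by
  let r : Set.range f → ι := fun x => x.2.choose
  have hr : ∀ x : Set.range f, f (r x) = x := fun x => x.2.choose_spec
  let F : Set.range f → Set.range g := fun x => ⟨g (r x), r x, rfl⟩
  have hF : Function.Bijective F := by
    constructor
    · intro x y hxy
      have h : g (r x) = g (r y) := congrArg Subtype.val hxy
      rw [← he, hr, hr] at h
      exact Subtype.ext h
    · rintro ⟨_, i, rfl⟩
      refine ⟨⟨f i, i, rfl⟩, Subtype.ext ?_⟩
      exact (he _ _).1 (hr _)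
  let e : Iso (G.induce (Set.range f)) (G.induce (Set.range g)) :=
    { toIso :=
        { toEquiv := Equiv.ofBijective F hF
          map_rel_iff' := by
            intro x y
            change G.graph.Adj (g (r x)) (g (r y)) ↔ G.graph.Adj x y
            rw [← ha, hr, hr] }
      map_color := by
        intro x
        change G.color (g (r x)) = G.color x
        rw [← hc, hr] }
  obtain ⟨φ, hφ⟩ := hG _ _ (Set.finite_range f) (Set.finite_range g) e
  refine ⟨φ, fun i => ?_⟩
  refine (hφ ⟨f i, i, rfl⟩).trans ?_
  exact (he _ _).1 (hr _)

/-- A tuple of distinct vertices of one monochromatic clique together with a vertex of the other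
colour is determined up to automorphisms by the adjacencies of that last vertex. -/
theorem Ultrahomogeneous.exists_iso_cone (hG : G.Ultrahomogeneous)
    (hcl : ∀ c, G.IsCliqueUnion c) {ι : Type*} [Finite ι] {s t : ι → V}
    (hs : Function.Injective s) (ht : Function.Injective t) {x x' y y' : V}
    (hxs : ∀ i, G.Near x (s i)) (hxt : ∀ i, G.Near x' (t i)) (hx : G.color x = G.color x')
    (hy : G.color y = G.color y') (hxy : G.color x ≠ G.color y)
    (ha : ∀ i, G.graph.Adj (s i) y ↔ G.graph.Adj (t i) y') :
    ∃ φ : Iso G G, (∀ i, φ.toIso (s i) = t i) ∧ φ.toIso y = y' := by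
  have hsy : ∀ i, s i ≠ y := fun i h => hxy ((hxs i).1.trans (by rw [h]))
  have hty : ∀ i, t i ≠ y' := fun i h => hxy (hx.trans ((hxt i).1.trans (by rw [h, hy])))
  obtain ⟨φ, hφ⟩ := hG.exists_iso (fun i : Option ι => i.elim y s) (fun i => i.elim y' t)
    (by
      rintro (_ | i)
      · exact hy
      · exact (hxs i).1.symm.trans (hx.trans (hxt i).1))
    (by
      rintro (_ | i) (_ | j)
      · simp
      · simp [(hsy j).symm, (hty j).symm]
      · simp [hsy i, hty i]
      · simp [hs.eq_iff, ht.eq_iff])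
    (by
      rintro (_ | i) (_ | j)
      · simp
      · simpa [G.graph.adj_comm] using ha j
      · exact ha i
      · by_cases hij : i = j
        · subst hij; simp
        · have h1 := (((hxs i).symm.trans hcl (hxs j))).adj (hs.ne hij)
          have h2 := (((hxt i).symm.trans hcl (hxt j))).adj (ht.ne hij)
          exact iff_of_true h1 h2)
  exact ⟨φ, fun i => hφ (some i), hφ none⟩

theorem Ultrahomogeneous.exists_iso_pair (hG : G.Ultrahomogeneous) {x x' y y' : V}
    (hx : G.color x = G.color x') (hy : G.color y = G.color y') (hxy : G.color x ≠ G.color y)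
    (ha : G.graph.Adj x y ↔ G.graph.Adj x' y') :
    ∃ φ : Iso G G, φ.toIso x = x' ∧ φ.toIso y = y' := by
  have h1 : x ≠ y := fun h => hxy (by rw [h])
  have h2 : x' ≠ y' := fun h => hxy (by rw [hx, hy, h])
  obtain ⟨φ, hφ⟩ := hG.exists_iso ![x, y] ![x', y'] (by simp [Fin.forall_fin_two, hx, hy])
    (by simp [Fin.forall_fin_two, h1, h2, h1.symm, h2.symm])
    (by simp [Fin.forall_fin_two, ha, G.graph.adj_comm y x, G.graph.adj_comm y' x'])
  exact ⟨φ, hφ 0, hφ 1⟩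

theorem Ultrahomogeneous.exists_iso_triple (hG : G.Ultrahomogeneous) {x₁ x₂ y x₁' x₂' y' : V}
    (h₁ : G.color x₁ = G.color x₁') (h₂ : G.color x₂ = G.color x₂')
    (hy : G.color y = G.color y') (h₁y : G.color x₁ ≠ G.color y) (h₂y : G.color x₂ ≠ G.color y)
    (hne : x₁ ≠ x₂) (hne' : x₁' ≠ x₂') (ha : G.graph.Adj x₁ x₂ ↔ G.graph.Adj x₁' x₂')
    (ha₁ : G.graph.Adj x₁ y ↔ G.graph.Adj x₁' y') (ha₂ : G.graph.Adj x₂ y ↔ G.graph.Adj x₂' y') :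
    ∃ φ : Iso G G, φ.toIso x₁ = x₁' ∧ φ.toIso x₂ = x₂' ∧ φ.toIso y = y' := by
  have e1 : x₁ ≠ y := fun h => h₁y (by rw [h])
  have e2 : x₂ ≠ y := fun h => h₂y (by rw [h])
  have e3 : x₁' ≠ y' := fun h => h₁y (by rw [h₁, hy, h])
  have e4 : x₂' ≠ y' := fun h => h₂y (by rw [h₂, hy, h])
  obtain ⟨φ, hφ⟩ := hG.exists_iso ![x₁, x₂, y] ![x₁', x₂', y']
    (by simp [Fin.forall_fin_succ, h₁, h₂, hy])
    (by simp [Fin.forall_fin_succ, e1, e2, e3, e4, e1.symm, e2.symm, e3.symm, e4.symm, hne, hne',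
      hne.symm, hne'.symm])
    (by simp [Fin.forall_fin_succ, ha, ha₁, ha₂, G.graph.adj_comm y, G.graph.adj_comm x₂ x₁,
      G.graph.adj_comm y', G.graph.adj_comm x₂' x₁'])
  exact ⟨φ, hφ 0, hφ 1, hφ 2⟩

/-! ### Complementing the cross edges -/

theorem crossCompl_adj_of_ne {x y : V} (h : G.color x ≠ G.color y) :
    G.crossCompl.graph.Adj x y ↔ ¬ G.graph.Adj x y := by
  simp [crossCompl, h]

theorem crossCompl_adj_of_eq {x y : V} (h : G.color x = G.color y) :
    G.crossCompl.graph.Adj x y ↔ G.graph.Adj x y := by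
  simp [crossCompl, h]

theorem crossCompl_near {x y : V} : G.crossCompl.Near x y ↔ G.Near x y := by
  by_cases h : G.color x = G.color y
  · simp only [Near, crossCompl_adj_of_eq h]; rfl
  · exact iff_of_false (fun h' => h h'.1) fun h' => h h'.1

theorem crossCompl_crossCompl : G.crossCompl.crossCompl = G := by
  obtain ⟨g, c⟩ := G
  simp only [crossCompl, TwoColoredGraph.mk.injEq, and_true]
  ext x y
  by_cases h : c x = c y <;> simp [h]

theorem crossCompl_isCliqueUnion (hcl : ∀ c, G.IsCliqueUnion c) (c : Color) :
    G.crossCompl.IsCliqueUnion c := by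
  intro x hx y hy z hz hxy hyz hxz
  have hx : G.color x = c := hx
  have hy : G.color y = c := hy
  have hz : G.color z = c := hz
  rw [crossCompl_adj_of_eq (by rw [hx, hy])] at hxy
  rw [crossCompl_adj_of_eq (by rw [hy, hz])] at hyz
  rw [crossCompl_adj_of_eq (by rw [hx, hz])]
  exact hcl c x hx y hy z hz hxy hyz hxz

/-- A colour-preserving isomorphism is also one between the cross-complements. -/
def Iso.crossCompl {H : TwoColoredGraph W} (φ : Iso G H) : Iso G.crossCompl H.crossCompl where
  toIso :=
    { toEquiv := φ.toIso.toEquiv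
      map_rel_iff' := by
        intro x y
        change H.crossCompl.graph.Adj (φ.toIso x) (φ.toIso y) ↔ _
        simp only [TwoColoredGraph.crossCompl, φ.map_color, φ.adj_iff] }
  map_color := φ.map_color

theorem Ultrahomogeneous.crossCompl (hG : G.Ultrahomogeneous) :
    G.crossCompl.Ultrahomogeneous := by
  intro s t hs ht f
  have hc : ∀ x : s, G.color (f.toIso x) = G.color x := f.map_color
  let f' : Iso (G.induce s) (G.induce t) :=
    { toIso :=
        { toEquiv := f.toIso.toEquiv
          map_rel_iff' := by
            intro x y
            change G.graph.Adj (f.toIso x) (f.toIso y) ↔ G.graph.Adj x y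
            have h : G.crossCompl.graph.Adj (f.toIso x) (f.toIso y) ↔
              G.crossCompl.graph.Adj x y := f.adj_iff
            by_cases hxy : G.color x = G.color y
            · rwa [crossCompl_adj_of_eq hxy, crossCompl_adj_of_eq (by rw [hc, hc, hxy])] at h
            · rwa [crossCompl_adj_of_ne hxy, crossCompl_adj_of_ne (by rwa [hc, hc]),
                not_iff_not] at h }
      map_color := f.map_color }
  obtain ⟨g, hg⟩ := hG s t hs ht f'
  exact ⟨g.crossCompl, hg⟩

/-! ### Induced subgraphs as embeddings -/

theorem realizes_iff : G.Realizes H ↔ ∃ f : W → V, Function.Injective f ∧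
    (∀ x, G.color (f x) = H.color x) ∧
    ∀ x y, G.graph.Adj (f x) (f y) ↔ H.graph.Adj x y := by
  constructor
  · rintro ⟨s, ⟨φ⟩⟩
    exact ⟨fun x => φ.toIso x, Subtype.val_injective.comp φ.toIso.injective, φ.map_color,
      fun x y => φ.adj_iff⟩
  · rintro ⟨f, hf, hc, ha⟩
    exact ⟨Set.range f, ⟨{
      toIso :=
        { toEquiv := Equiv.ofInjective f hf
          map_rel_iff' := fun {x y} => ha x y }
      map_color := hc }⟩⟩

theorem Realizes.trans {U : Type*} {K : TwoColoredGraph U} (h₁ : G.Realizes H)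
    (h₂ : H.Realizes K) : G.Realizes K := by
  rw [realizes_iff] at *
  obtain ⟨f, hf, hfc, hfa⟩ := h₁
  obtain ⟨g, hg, hgc, hga⟩ := h₂
  exact ⟨f ∘ g, hf.comp hg, fun x => (hfc _).trans (hgc _), fun x y => (hfa _ _).trans (hga _ _)⟩

theorem realizes_refl (H : TwoColoredGraph W) : H.Realizes H :=
  realizes_iff.2 ⟨id, Function.injective_id, fun _ => rfl, fun _ _ => Iff.rfl⟩

theorem realizes_crossCompl_iff : G.Realizes H.crossCompl ↔ G.crossCompl.Realizes H := by
  simp only [realizes_iff]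
  refine exists_congr fun f => and_congr_right fun _ => and_congr_right fun hc => ?_
  refine forall_congr' fun x => forall_congr' fun y => ?_
  have hc : ∀ x, G.color (f x) = H.color x := hc
  by_cases h : H.color x = H.color y
  · rw [crossCompl_adj_of_eq h, crossCompl_adj_of_eq (by rw [hc, hc, h])]
  · rw [crossCompl_adj_of_ne h, crossCompl_adj_of_ne (by rwa [hc, hc])]
    tauto

/-- Some two vertices of one monochromatic clique and two vertices of a clique of the other colour
span exactly three cross edges. The roles of the two colours are interchangeable. -/
def HasThreeCross (G : TwoColoredGraph V) : Prop :=
  ∃ x x' y y', G.Near x x' ∧ G.Near y y' ∧ G.color x ≠ G.color y ∧ G.graph.Adj x y ∧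
    G.graph.Adj x y' ∧ G.graph.Adj x' y ∧ ¬ G.graph.Adj x' y'

theorem realizes_diamond_iff : G.Realizes diamond ↔ G.HasThreeCross := by
  rw [realizes_iff]
  constructor
  · rintro ⟨f, hf, hc, ha⟩
    refine ⟨f 0, f 1, f 2, f 3, ⟨by simp [hc, diamond], Or.inr ?_⟩,
      ⟨by simp [hc, diamond], Or.inr ?_⟩, by simp [hc, diamond], ?_, ?_, ?_, ?_⟩ <;>
    simp [ha, diamond]
  · have key : ∀ x x' y y', G.Near x x' → G.Near y y' → G.color x = Color.red →
        G.color y = Color.blue → G.graph.Adj x y → G.graph.Adj x y' → G.graph.Adj x' y →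
        ¬ G.graph.Adj x' y' → ∃ f : Fin 4 → V, Function.Injective f ∧
          (∀ x, G.color (f x) = diamond.color x) ∧
          ∀ x y, G.graph.Adj (f x) (f y) ↔ diamond.graph.Adj x y := by
      intro x x' y y' hx hy hcx hcy h1 h2 h3 h4
      have hxx : x ≠ x' := by rintro rfl; exact h4 h2
      have hyy : y ≠ y' := by rintro rfl; exact h4 h3
      have hcx' := hx.1.symm.trans hcx
      have hcy' := hy.1.symm.trans hcy
      have a1 := hx.adj hxx
      have a2 := hy.adj hyy
      have n1 : x' ≠ y' := by rintro rfl; simp_all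
      refine ⟨![x, x', y, y'], ?_, ?_, ?_⟩
      · intro i j
        fin_cases i <;> fin_cases j <;>
          simp [hxx, hyy, hxx.symm, hyy.symm, h1.ne, h2.ne, h3.ne, n1, h1.ne', h2.ne', h3.ne',
            n1.symm]
      · intro i
        fin_cases i <;> simp [diamond, hcx, hcy, hcx', hcy']
      · intro i j
        fin_cases i <;> fin_cases j <;>
          simp [diamond, a1, a2, a1.symm, a2.symm, h1, h2, h3, h4, h1.symm, h2.symm, h3.symm,
            G.graph.adj_comm y' x']
    rintro ⟨x, x', y, y', hx, hy, hxy, h1, h2, h3, h4⟩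
    cases hcx : G.color x <;> cases hcy : G.color y
    · simp_all
    · exact key x x' y y' hx hy hcx hcy h1 h2 h3 h4
    · exact key y y' x x' hy hx hcy hcx h1.symm h3.symm h2.symm fun h => h4 h.symm
    · simp_all

/-! ### Maximal cliques and piecewise ultrahomogeneity -/

theorem isMaximalClique_near (hcl : ∀ c, G.IsCliqueUnion c) (x : V) :
    G.IsMaximalClique (G.color x) {z | G.Near x z} := by
  refine ⟨⟨fun z hz => hz.1.symm, fun z hz w hw hne => (hz.symm.trans hcl hw).adj hne⟩, ?_⟩
  rintro s ⟨hs, hsc⟩ hle z hz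
  have hx : x ∈ s := hle (Near.refl x)
  refine ⟨(hs hz).symm, ?_⟩
  by_cases h : x = z
  · exact Or.inl h
  · exact Or.inr (hsc hx hz h)

theorem IsMaximalClique.exists_eq (hcl : ∀ c, G.IsCliqueUnion c) {c : Color} {M : Set V}
    (hM : G.IsMaximalClique c M) (hc : (G.colorClass c).Nonempty) :
    ∃ x, G.color x = c ∧ M = {z | G.Near x z} := by
  have hne : M.Nonempty := by
    by_contra h
    rw [Set.not_nonempty_iff_eq_empty] at h
    obtain ⟨v, hv⟩ := hc
    have := hM.2 (y := {v}) ⟨by simpa using hv, by simp⟩ (by simp [h])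
    simp [h] at this
  obtain ⟨x, hx⟩ := hne
  have hxc : G.color x = c := hM.1.1 hx
  refine ⟨x, hxc, Set.Subset.antisymm ?_ ?_⟩
  · intro z hz
    refine ⟨hxc.trans (hM.1.1 hz).symm, ?_⟩
    by_cases h : x = z
    · exact Or.inl h
    · exact Or.inr (hM.1.2 hx hz h)
  · have h := isMaximalClique_near hcl x
    rw [hxc] at h
    refine hM.2 h.1 fun z hz => ⟨hxc.trans (hM.1.1 hz).symm, ?_⟩
    by_cases h : x = z
    · exact Or.inl h
    · exact Or.inr (hM.1.2 hx hz h)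

theorem PiecewiseUltrahomogeneous.induce_near (h : G.PiecewiseUltrahomogeneous)
    (hcl : ∀ c, G.IsCliqueUnion c) {x y : V} (hxy : G.color x ≠ G.color y) :
    (G.induce {z | G.Near x z ∨ G.Near y z}).Ultrahomogeneous := by
  have hx := isMaximalClique_near hcl x
  have hy := isMaximalClique_near hcl y
  cases hcx : G.color x <;> cases hcy : G.color y
  · simp_all
  · rw [hcx] at hx
    rw [hcy] at hy
    exact h _ _ hx hy
  · rw [hcx] at hx
    rw [hcy] at hy
    rw [Set.ofPred_or, Set.union_comm]
    exact h _ _ hy hx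
  · simp_all

/-- The consequence of piecewise ultrahomogeneity that the argument needs: in the subgraph induced
by two cliques of different colours, a pair of vertices of one clique can be moved to any other such
pair while the adjacencies to the other clique are permuted. -/
theorem PiecewiseUltrahomogeneous.exists_perm (h : G.PiecewiseUltrahomogeneous)
    (hcl : ∀ c, G.IsCliqueUnion c) {x y x₁ x₂ x₁' x₂' : V} (hxy : G.color x ≠ G.color y)
    (h₁ : G.Near x x₁) (h₂ : G.Near x x₂) (h₁' : G.Near x x₁') (h₂' : G.Near x x₂')
    (hne : x₁ = x₂ ↔ x₁' = x₂') {w : V} (hw : G.Near y w) :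
    ∃ v, G.Near y v ∧ (G.graph.Adj x₁ v ↔ G.graph.Adj x₁' w) ∧
      (G.graph.Adj x₂ v ↔ G.graph.Adj x₂' w) := by
  let S : Set V := {z | G.Near x z ∨ G.Near y z}
  have hU : (G.induce S).Ultrahomogeneous := h.induce_near hcl hxy
  have ha : ∀ {a b}, G.Near x a → G.Near x b → (G.graph.Adj a b ↔ a ≠ b) := fun ha hb =>
    ⟨fun h => h.ne, fun h => (ha.symm.trans hcl hb).adj h⟩
  let a₁ : S := ⟨x₁, Or.inl h₁⟩
  let a₂ : S := ⟨x₂, Or.inl h₂⟩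
  let a₁' : S := ⟨x₁', Or.inl h₁'⟩
  let a₂' : S := ⟨x₂', Or.inl h₂'⟩
  obtain ⟨φ, hφ⟩ := hU.exists_iso ![a₁, a₂] ![a₁', a₂']
    (by
      simp only [Fin.forall_fin_two]
      exact ⟨h₁.1.symm.trans h₁'.1, h₂.1.symm.trans h₂'.1⟩)
    (by
      simp only [Fin.forall_fin_two]
      simp [a₁, a₂, a₁', a₂', hne, eq_comm (a := x₂), eq_comm (a := x₂')])
    (by
      simp only [Fin.forall_fin_two]
      simp [a₁, a₂, a₁', a₂', induce, *, eq_comm (a := x₂), eq_comm (a := x₂')])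
  have e1 : φ.toIso a₁ = a₁' := hφ 0
  have e2 : φ.toIso a₂ = a₂' := hφ 1
  obtain ⟨⟨v, hv⟩, hvw⟩ := φ.exists_preimage ⟨w, Or.inr hw⟩
  have hc : G.color w = G.color v := by
    have := φ.map_color ⟨v, hv⟩
    rw [hvw] at this
    exact this
  refine ⟨v, hv.resolve_left fun h => hxy (h.1.trans (hc.symm.trans hw.1.symm)), ?_, ?_⟩
  · have := φ.adj_iff (x := a₁) (y := ⟨v, hv⟩)
    rw [e1, hvw] at this
    exact this.symm
  · have := φ.adj_iff (x := a₂) (y := ⟨v, hv⟩)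
    rw [e2, hvw] at this
    exact this.symm

/-- A criterion for piecewise ultrahomogeneity. Only maps between subsets of one clique `M` are
problematic, as an extension to `G` may move the clique `N` of the other colour; it can be chosen
to preserve `N` if vertices of `N` can be added to domain and range. -/
theorem Ultrahomogeneous.piecewise {V : Type u} {G : TwoColoredGraph V}
    (hG : G.Ultrahomogeneous) (hcl : ∀ c, G.IsCliqueUnion c)
    (hne : ∀ c, (G.colorClass c).Nonempty)
    (h : ∀ x y : V, G.color x ≠ G.color y → ∀ (ι : Type u) [Finite ι] [Nonempty ι] (s t : ι → V),
      Function.Injective s → Function.Injective t → (∀ i, G.Near x (s i)) →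
      (∀ i, G.Near x (t i)) → ∃ y₁ y₂, G.Near y y₁ ∧ G.Near y y₂ ∧
        ∀ i, G.graph.Adj (s i) y₁ ↔ G.graph.Adj (t i) y₂) :
    G.PiecewiseUltrahomogeneous := by
  intro M N hM hN
  obtain ⟨x, hx, rfl⟩ := hM.exists_eq hcl (hne _)
  obtain ⟨y, hy, rfl⟩ := hN.exists_eq hcl (hne _)
  have hxy : G.color x ≠ G.color y := by simp [hx, hy]
  set U : Set V := {z | G.Near x z} ∪ {z | G.Near y z} with hU
  intro S T hS hT f
  have hfc : ∀ a : S, G.color (f.toIso a).1 = G.color a.1 := f.map_color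
  have hfa : ∀ a b : S, G.graph.Adj (f.toIso a).1 (f.toIso b).1 ↔ G.graph.Adj a.1 b.1 :=
    fun a b => f.adj_iff
  have memx : ∀ z : U, G.color z = G.color x → G.Near x z := fun z hz =>
    z.2.resolve_right fun h => hxy (hz.symm.trans h.1.symm)
  have memy : ∀ z : U, G.color z = G.color y → G.Near y z := fun z hz =>
    z.2.resolve_left fun h => hxy (h.1.trans hz)
  -- It suffices to extend `f` to an automorphism of `G` that preserves both cliques.
  suffices hφ : ∃ φ : Iso G G, (∀ a : S, φ.toIso a.1.1 = (f.toIso a).1.1) ∧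
      (∀ z, G.Near x (φ.toIso z) ↔ G.Near x z) ∧ (∀ z, G.Near y (φ.toIso z) ↔ G.Near y z) by
    obtain ⟨φ, hφ, hφx, hφy⟩ := hφ
    have hφU : ∀ z, z ∈ U ↔ φ.toIso z ∈ U := fun z => (or_congr (hφx z) (hφy z)).symm
    refine ⟨{ toIso :=
                { toEquiv := φ.toIso.toEquiv.subtypeEquiv hφU
                  map_rel_iff' := fun {a b} => φ.adj_iff (x := a.1) (y := b.1) }
              map_color := fun a => φ.map_color a.1 }, fun a => Subtype.ext (hφ a)⟩
  have pres : ∀ (φ : Iso G G) (u a : V), G.Near u a → G.Near u (φ.toIso a) →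
      ∀ z, G.Near u (φ.toIso z) ↔ G.Near u z := by
    intro φ u a h1 h2 z
    constructor
    · intro h
      exact h1.trans hcl (φ.near_iff.1 (h2.symm.trans hcl h))
    · intro h
      exact h2.trans hcl (φ.near_iff.2 (h1.symm.trans hcl h))
  have : Finite S := hS
  -- A map between subsets of one clique.
  have one : ∀ u v : V, G.color u ≠ G.color v → Nonempty S → (∀ a : S, G.Near u a.1) →
      (∀ a : S, G.Near u (f.toIso a).1) → ∃ φ : Iso G G,
        (∀ a : S, φ.toIso a.1.1 = (f.toIso a).1.1) ∧
        (∀ z, G.Near u (φ.toIso z) ↔ G.Near u z) ∧ (∀ z, G.Near v (φ.toIso z) ↔ G.Near v z) := by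
    rintro u v huv ⟨a⟩ h1 h2
    have i1 : Function.Injective fun a : S => a.1.1 :=
      Subtype.val_injective.comp Subtype.val_injective
    have i2 : Function.Injective fun a : S => (f.toIso a).1.1 :=
      Subtype.val_injective.comp (Subtype.val_injective.comp f.toIso.injective)
    have : Nonempty S := ⟨a⟩
    obtain ⟨y₁, y₂, hy₁, hy₂, hyy⟩ := h u v huv S _ _ i1 i2 h1 h2
    obtain ⟨φ, hφ1, hφ2⟩ := hG.exists_iso_cone hcl i1 i2 h1 h2 rfl (hy₁.1.symm.trans hy₂.1)
      (by rwa [← hy₁.1]) hyy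
    refine ⟨φ, hφ1, pres φ u a.1 (h1 a) ?_, pres φ v y₁ hy₁ (by rwa [hφ2])⟩
    rw [hφ1]
    exact h2 a
  rcases isEmpty_or_nonempty S with hE | hNE
  · exact ⟨⟨SimpleGraph.Iso.refl, fun _ => rfl⟩, fun a => hE.elim a, fun _ => Iff.rfl,
      fun _ => Iff.rfl⟩
  by_cases hSx : ∀ a : S, G.color a.1 = G.color x
  · exact one x y hxy hNE (fun a => memx _ (hSx a)) fun a => memx _ ((hfc a).trans (hSx a))
  by_cases hSy : ∀ a : S, G.color a.1 = G.color y
  · obtain ⟨φ, h1, h2, h3⟩ := one y x hxy.symm hNE (fun a => memy _ (hSy a))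
      fun a => memy _ ((hfc a).trans (hSy a))
    exact ⟨φ, h1, h3, h2⟩
  push Not at hSx hSy
  obtain ⟨b, hb⟩ := hSx
  obtain ⟨a, ha⟩ := hSy
  have ha : G.color a.1 = G.color x := by
    rw [hy] at ha
    rw [hx]
    exact (color_ne_iff (by simp)).1 ha
  have hb : G.color b.1 = G.color y := by
    rw [hx] at hb
    rw [hy]
    exact (color_ne_iff (by simp)).1 hb
  obtain ⟨φ, hφ⟩ := hG.exists_iso (fun a : S => a.1.1) (fun a : S => (f.toIso a).1.1)
    (fun a => (hfc a).symm)
    (fun a b => by simp [Subtype.ext_iff.symm])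
    (fun a b => (hfa a b).symm)
  refine ⟨φ, hφ, pres φ x a.1 (memx _ ha) ?_, pres φ y b.1 (memy _ hb) ?_⟩
  · rw [hφ]
    exact memx _ ((hfc a).trans ha)
  · rw [hφ]
    exact memy _ ((hfc b).trans hb)

/-! ### Blow-ups -/

/-- If no vertex splits a clique of colour `c`, and these cliques are nontrivial, then each of
them consists of twins, and shrinking them exhibits `G` as a blow-up. -/
theorem Ultrahomogeneous.isBlowUp [Countable V] (hG : G.Ultrahomogeneous)
    (hcl : ∀ c, G.IsCliqueUnion c) {c : Color} {y₀ y₁ : V} (hy₀ : G.color y₀ = c)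
    (hy : G.Near y₀ y₁) (hne : y₀ ≠ y₁)
    (htwin : ∀ x y y', G.color x ≠ c → G.color y = c → G.Near y y' → G.graph.Adj x y →
      G.graph.Adj x y') : G.IsBlowUp := by
  classical
  let sd : Setoid V := ⟨G.Near, Near.refl, Near.symm, fun h h' => Near.trans hcl h h'⟩
  let rep : V → V := fun v => (Quotient.mk sd v).out
  have rep_near : ∀ v, G.Near (rep v) v := fun v => @Quotient.mk_out V sd v
  have rep_eq : ∀ {v w}, G.Near v w → rep v = rep w := fun h =>
    congrArg Quotient.out (Quotient.sound h)
  have rep_rep : ∀ v, rep (rep v) = rep v := fun v => rep_eq (rep_near v)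
  let S : Set V := {v | G.color v ≠ c ∨ rep v = v}
  have hφ : ∀ w : V, G.color w = c → ∃ φ : Iso G G, φ.toIso w = y₀ := by
    intro w hw
    obtain ⟨φ, hφ⟩ := hG.exists_iso (fun _ : Unit => w) (fun _ => y₀) (fun _ => hw.trans hy₀.symm)
      (by simp) (by simp)
    exact ⟨φ, hφ ()⟩
  choose φ hφ using hφ
  let N : Set V := {z | G.Near y₀ z}
  obtain ⟨F, hF⟩ := exists_injective_nat N
  have repS : ∀ v, rep v ∈ S := fun v => Or.inr (rep_rep v)
  have repc : ∀ v, G.color v = c → G.color (rep v) = c := fun v hv => (rep_near v).1.trans hv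
  have hmem : ∀ v (hv : G.color v = c), (φ (rep v) (repc v hv)).toIso v ∈ N := by
    intro v hv
    have := (φ (rep v) (repc v hv)).near_iff.2 (rep_near v)
    rwa [hφ] at this
  let Φ : V → BlowUpVertex (G.induce S) c (Set.range F) := fun v =>
    if hv : G.color v = c then
      Sum.inl (⟨⟨rep v, repS v⟩, repc v hv⟩, ⟨F ⟨(φ (rep v) (repc v hv)).toIso v, hmem v hv⟩,
        Set.mem_range_self _⟩)
    else Sum.inr ⟨⟨v, Or.inl hv⟩, hv⟩
  have Φpos : ∀ v (hv : G.color v = c), Φ v = Sum.inl (⟨⟨rep v, repS v⟩, repc v hv⟩,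
      ⟨F ⟨(φ (rep v) (repc v hv)).toIso v, hmem v hv⟩, Set.mem_range_self _⟩) :=
    fun v hv => dif_pos hv
  have Φneg : ∀ v (hv : ¬ G.color v = c), Φ v = Sum.inr ⟨⟨v, Or.inl hv⟩, hv⟩ :=
    fun v hv => dif_neg hv
  have base_pos : ∀ v, G.color v = c → ((Φ v).base : V) = rep v := by
    intro v hv
    rw [Φpos v hv]
    rfl
  have base_neg : ∀ v, ¬ G.color v = c → ((Φ v).base : V) = v := by
    intro v hv
    rw [Φneg v hv]
    rfl
  have hinj : Function.Injective Φ := by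
    intro v w hvw
    by_cases hv : G.color v = c <;> by_cases hw : G.color w = c
    · rw [Φpos v hv, Φpos w hw] at hvw
      have h := Prod.ext_iff.1 (Sum.inl.inj hvw)
      have h1 : rep v = rep w := congrArg (fun z => z.1.1) h.1
      have h2 := congrArg Subtype.val (hF (Subtype.ext_iff.1 h.2))
      simp only [h1] at h2
      exact (φ _ _).toIso.injective h2
    · rw [Φpos v hv, Φneg w hw] at hvw
      cases hvw
    · rw [Φneg v hv, Φpos w hw] at hvw
      cases hvw
    · rw [Φneg v hv, Φneg w hw] at hvw
      exact congrArg (fun z => z.1.1) (Sum.inr.inj hvw)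
  have hsurj : Function.Surjective Φ := by
    rintro (⟨⟨⟨w, hwS⟩, hw⟩, ⟨_, ⟨n, rfl⟩⟩⟩ | ⟨⟨w, hwS⟩, hw⟩)
    · have hw : G.color w = c := hw
      have hrw : rep w = w := hwS.resolve_left fun h => h hw
      obtain ⟨v, hv⟩ := (φ w hw).exists_preimage n
      have hwv : G.Near w v := by
        rw [← (φ w hw).near_iff, hφ, hv]
        exact n.2
      have hvc : G.color v = c := hwv.1.symm.trans hw
      have hrv : rep v = w := (rep_eq hwv).symm.trans hrw
      refine ⟨v, ?_⟩
      rw [Φpos v hvc]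
      have : ∀ (u : V) (hu : G.color u = c), u = w → (φ u hu).toIso v = n := by
        rintro u hu rfl
        exact hv
      congr 1
      refine Prod.ext (Subtype.ext (Subtype.ext hrv)) (Subtype.ext ?_)
      exact congrArg F (Subtype.ext (this _ _ hrv))
    · exact ⟨w, Φneg w hw⟩
  have hadj : ∀ v w, G.graph.Adj ((Φ v).base : V) ((Φ w).base : V) ∨
      ((Φ v).base = (Φ w).base ∧ Φ v ≠ Φ w) ↔ G.graph.Adj v w := by
    have mixed : ∀ v w, G.color v = c → ¬ G.color w = c →
        (G.graph.Adj (rep v) w ↔ G.graph.Adj v w) := by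
      intro v w hv hw
      exact ⟨fun h => (htwin w _ _ hw (repc v hv) (rep_near v) h.symm).symm,
        fun h => (htwin w _ _ hw hv (rep_near v).symm h.symm).symm⟩
    intro v w
    rw [hinj.ne_iff, Subtype.ext_iff]
    by_cases hv : G.color v = c <;> by_cases hw : G.color w = c
    · rw [base_pos v hv, base_pos w hw]
      constructor
      · rintro (h | ⟨h, h'⟩)
        · have h3 : G.Near (rep v) (rep w) := ⟨(repc v hv).trans (repc w hw).symm, Or.inr h⟩
          have := rep_eq h3
          rw [rep_rep, rep_rep] at this
          exact absurd this h.ne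
        · exact ((rep_near v).symm.trans hcl (h ▸ rep_near w)).adj h'
      · intro h
        exact Or.inr ⟨rep_eq ⟨hv.trans hw.symm, Or.inr h⟩, h.ne⟩
    · rw [base_pos v hv, base_neg w hw, mixed v w hv hw, or_iff_left]
      rintro ⟨h, -⟩
      exact hw (h ▸ repc v hv)
    · rw [base_neg v hv, base_pos w hw, G.graph.adj_comm, mixed w v hw hv, or_iff_left,
        G.graph.adj_comm]
      rintro ⟨h, -⟩
      exact hv (h ▸ repc w hw)
    · rw [base_neg v hv, base_neg w hw, or_iff_left]
      rintro ⟨h, h'⟩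
      exact h' h
  refine ⟨S, G.induce S, c, Set.range F, ⟨⟨rep y₀, repS y₀⟩, repc y₀ hy₀⟩, ?_, inferInstance, ?_,
    ⟨⟨⟨Equiv.ofBijective Φ ⟨hinj, hsurj⟩, fun {v w} => hadj v w⟩, ?_⟩⟩⟩
  · rintro ⟨a, ha⟩ hac ⟨b, hb⟩ hbc - hab
    have hac : G.color a = c := hac
    have hbc : G.color b = c := hbc
    have h : G.graph.Adj a b := hab
    have h1 := hb.resolve_left fun h => h hbc
    have h2 := ha.resolve_left fun h => h hac
    exact h.ne (h2.symm.trans ((rep_eq ⟨hac.trans hbc.symm, Or.inr h⟩).trans h1))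
  · refine ⟨⟨_, Set.mem_range_self ⟨y₀, Near.refl y₀⟩⟩, ⟨_, Set.mem_range_self ⟨y₁, hy⟩⟩, ?_⟩
    intro h
    exact hne (congrArg Subtype.val (hF (congrArg Subtype.val h)))
  · intro v
    change G.color ((Φ v).base : V) = G.color v
    by_cases hv : G.color v = c
    · rw [base_pos v hv, repc v hv, hv]
    · rw [base_neg v hv]

/-! ### Splitting cliques -/

/-- Every vertex has both a neighbour and a non-neighbour in each clique of the other colour. -/
def Splits (G : TwoColoredGraph V) : Prop :=
  ∀ x y, G.color x ≠ G.color y →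
    (∃ y₁, G.Near y y₁ ∧ G.graph.Adj x y₁) ∧ ∃ y₂, G.Near y y₂ ∧ ¬ G.graph.Adj x y₂

theorem Splits.crossCompl (h : G.Splits) : G.crossCompl.Splits := by
  intro x y hxy
  have hxy : G.color x ≠ G.color y := hxy
  obtain ⟨⟨y₁, h1, h1'⟩, y₂, h2, h2'⟩ := h x y hxy
  refine ⟨⟨y₂, crossCompl_near.2 h2, ?_⟩, y₁, crossCompl_near.2 h1, ?_⟩
  · rwa [crossCompl_adj_of_ne (by rwa [← h2.1])]
  · rwa [crossCompl_adj_of_ne (by rwa [← h1.1]), not_not]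

/-- Unless `G` is a blow-up, some vertex splits some nontrivial clique of the other colour. -/
theorem Ultrahomogeneous.exists_split [Countable V] (hG : G.Ultrahomogeneous)
    (hcl : ∀ c, G.IsCliqueUnion c) (hblow : ¬ G.IsBlowUp) {a b : V} (hab : G.Near a b)
    (hne : a ≠ b) : ∃ x y y', G.color x ≠ G.color a ∧ G.color y = G.color a ∧ G.Near y y' ∧
      G.graph.Adj x y ∧ ¬ G.graph.Adj x y' := by
  by_contra h
  refine hblow (hG.isBlowUp hcl rfl hab hne fun x y y' hx hy hyy hxy => ?_)
  by_contra hxy'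
  exact h ⟨x, y, y', hx, hy, hyy, hxy, hxy'⟩

theorem Ultrahomogeneous.splits [Countable V] (hG : G.Ultrahomogeneous)
    (hcl : ∀ c, G.IsCliqueUnion c) (hblow : ¬ G.IsBlowUp)
    (hpair : ∀ c, ∃ a b, G.color a = c ∧ G.Near a b ∧ a ≠ b) : G.Splits := by
  intro x y hxy
  obtain ⟨a, b, ha, hab, hne⟩ := hpair (G.color y)
  obtain ⟨x₀, y₀, y₀', hx₀, hy₀, hyy, h1, h2⟩ := hG.exists_split hcl hblow hab hne
  have hc : G.color x₀ = G.color x := by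
    rw [ha] at hx₀
    exact (color_ne_iff hxy.symm).1 hx₀
  rw [ha] at hx₀ hy₀
  by_cases h : G.graph.Adj x y
  · obtain ⟨φ, hφx, hφy⟩ := hG.exists_iso_pair hc hy₀ (by rwa [hy₀]) (iff_of_true h1 h)
    refine ⟨⟨y, Near.refl y, h⟩, φ.toIso y₀', ?_, ?_⟩
    · rwa [← hφy, φ.near_iff]
    · rwa [← hφx, φ.adj_iff]
  · obtain ⟨φ, hφx, hφy⟩ := hG.exists_iso_pair hc (hyy.1.symm.trans hy₀) (by rwa [← hyy.1, hy₀])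
      (iff_of_false h2 h)
    refine ⟨⟨φ.toIso y₀, ?_, ?_⟩, y, Near.refl y, h⟩
    · rw [← hφy, φ.near_iff]
      exact hyy.symm
    · rwa [← hφx, φ.adj_iff]

/-- If the pairs `(x₀, x₀')` and `(x, x')` lie in cliques of the same colour, then the types over
`(x₀, x₀')` that occur in the clique of `y₀` also occur over `(x, x')` in the clique of `y`,
as soon as `y₀` and `y` have the same type. -/
theorem Ultrahomogeneous.transfer (hG : G.Ultrahomogeneous) {x₀ x₀' y₀ y₀' x x' y : V}
    (hx₀ : G.Near x₀ x₀') (hx₀' : x₀ ≠ x₀') (hy₀ : G.Near y₀ y₀')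
    (hx : G.Near x x') (hx' : x ≠ x') (hcx : G.color x₀ = G.color x)
    (hcy : G.color y₀ = G.color y) (hxy : G.color x ≠ G.color y)
    (h : G.graph.Adj x₀ y₀ ↔ G.graph.Adj x y) (h' : G.graph.Adj x₀' y₀ ↔ G.graph.Adj x' y) :
    ∃ y', G.Near y y' ∧ (G.graph.Adj x y' ↔ G.graph.Adj x₀ y₀') ∧
      (G.graph.Adj x' y' ↔ G.graph.Adj x₀' y₀') := by
  obtain ⟨φ, h1, h2, h3⟩ := hG.exists_iso_triple hcx (hx₀.1.symm.trans (hcx.trans hx.1)) hcy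
    (by rwa [hcx, hcy]) (by rwa [← hx₀.1, hcx, hcy]) hx₀' hx'
    (iff_of_true (hx₀.adj hx₀') (hx.adj hx')) h h'
  refine ⟨φ.toIso y₀', ?_, ?_, ?_⟩
  · rwa [← h3, φ.near_iff]
  · rw [← h1, φ.adj_iff]
  · rw [← h2, φ.adj_iff]

/-- The three-edge configuration can be read with its first two vertices of either colour. -/
theorem HasThreeCross.exists_color (h : G.HasThreeCross) {c c' : Color} (hc : c ≠ c') :
    ∃ x x' y y', G.Near x x' ∧ G.Near y y' ∧ G.color x = c ∧ G.color y = c' ∧ G.graph.Adj x y ∧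
      G.graph.Adj x y' ∧ G.graph.Adj x' y ∧ ¬ G.graph.Adj x' y' := by
  obtain ⟨x, x', y, y', hx, hy, hxy, h1, h2, h3, h4⟩ := h
  by_cases hxc : G.color x = c
  · exact ⟨x, x', y, y', hx, hy, hxc, (color_ne_iff hc).1 (hxc ▸ hxy.symm), h1, h2, h3, h4⟩
  · have hxc' := (color_ne_iff hc).1 hxc
    exact ⟨y, y', x, x', hy, hx, (color_ne_iff hc.symm).1 (hxc' ▸ hxy.symm), hxc', h1.symm,
      h3.symm, h2.symm, fun h => h4 h.symm⟩

theorem hasThreeCross_crossCompl_iff : G.crossCompl.HasThreeCross ↔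
    ∃ x x' y y', G.Near x x' ∧ G.Near y y' ∧ G.color x ≠ G.color y ∧ ¬ G.graph.Adj x y ∧
      ¬ G.graph.Adj x y' ∧ ¬ G.graph.Adj x' y ∧ G.graph.Adj x' y' := by
  simp only [HasThreeCross, crossCompl_near]
  refine exists_congr fun x => exists_congr fun x' => exists_congr fun y => exists_congr fun y' =>
    and_congr_right fun hx => and_congr_right fun hy => and_congr_right fun hxy => ?_
  have hxy : G.color x ≠ G.color y := hxy
  rw [crossCompl_adj_of_ne hxy, crossCompl_adj_of_ne (hy.1 ▸ hxy),
    crossCompl_adj_of_ne (hx.1 ▸ hxy), crossCompl_adj_of_ne (hx.1 ▸ hy.1 ▸ hxy), not_not]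

theorem exists_color_of_crossCompl (h : G.crossCompl.HasThreeCross) {c c' : Color} (hc : c ≠ c') :
    ∃ x x' y y', G.Near x x' ∧ G.Near y y' ∧ G.color x = c ∧ G.color y = c' ∧
      ¬ G.graph.Adj x y ∧ ¬ G.graph.Adj x y' ∧ ¬ G.graph.Adj x' y ∧ G.graph.Adj x' y' := by
  obtain ⟨x, x', y, y', hx, hy, hxc, hyc, h1, h2, h3, h4⟩ := h.exists_color hc
  rw [crossCompl_near] at hx hy
  have hxy : G.color x ≠ G.color y := fun h => hc (hxc.symm.trans (h.trans hyc))
  rw [crossCompl_adj_of_ne hxy] at h1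
  rw [crossCompl_adj_of_ne (hy.1 ▸ hxy)] at h2
  rw [crossCompl_adj_of_ne (hx.1 ▸ hxy)] at h3
  rw [crossCompl_adj_of_ne (hx.1 ▸ hy.1 ▸ hxy), not_not] at h4
  exact ⟨x, x', y, y', hx, hy, hxc, hyc, h1, h2, h3, h4⟩

/-! ### Perfect matchings between cliques -/

/-- If one cross edge occurs among four vertices but three cross edges do not, then any two cliques
of different colours are joined by a perfect matching. -/
theorem Ultrahomogeneous.not_adj_of_not_hasThreeCross (hG : G.Ultrahomogeneous)
    (hcl : ∀ c, G.IsCliqueUnion c) (hS : G.Splits) (h : ¬ G.HasThreeCross)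
    (h' : G.crossCompl.HasThreeCross) {x x' y : V} (hx : G.Near x x')
    (hne : x ≠ x') (hxy : G.color x ≠ G.color y) (ha : G.graph.Adj x y) :
    ¬ G.graph.Adj x' y := by
  intro ha'
  obtain ⟨y', hy, hn⟩ := (hS x y hxy).2
  by_cases hn' : G.graph.Adj x' y'
  · exact h ⟨x', x, y, y', hx.symm, hy, hx.1 ▸ hxy, ha', hn', ha, hn⟩
  obtain ⟨x₀, x₀', y₀, y₀', hx₀, hy₀, hcx, hcy, h1, h2, h3, h4⟩ :=
    exists_color_of_crossCompl h' hxy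
  obtain ⟨y'', hy'', a1, a2⟩ := hG.transfer hx₀ (by rintro rfl; exact h2 h4) hy₀ hx hne hcx
    (hcy.trans hy.1) (hy.1 ▸ hxy) (iff_of_false h1 hn) (iff_of_false h3 hn')
  exact h ⟨x', x, y, y'', hx.symm, hy.trans hcl hy'', hx.1 ▸ hxy, ha', a2.2 h4, ha,
    fun h => h2 (a1.1 h)⟩

/-- If one cross edge occurs among four vertices but three cross edges do not, then each colour
class is a single clique. Otherwise, take a vertex `y`, its neighbours `x₁` and `z₁` in two
different cliques, a vertex `z₂ ≠ z₁` near `z₁`, and a vertex `w` near `y` adjacent to none of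
`x₁`, `z₁`, `z₂`. Some automorphism maps `(x₁, z₁, w)` to `(x₁, z₂, w)`. It preserves the clique
of `y`, so it fixes the unique neighbour `y` of `x₁` there, although `y` is adjacent to `z₁` and
not to `z₂`. -/
theorem Ultrahomogeneous.near_of_not_hasThreeCross (hG : G.Ultrahomogeneous)
    (hcl : ∀ c, G.IsCliqueUnion c) (hS : G.Splits)
    (h : ¬ G.HasThreeCross) (h' : G.crossCompl.HasThreeCross) {x z y : V}
    (hxz : G.color x = G.color z) (hxy : G.color x ≠ G.color y) : G.Near x z := by
  have no11 : ∀ {x x' y : V}, G.Near x x' → x ≠ x' → G.color x ≠ G.color y → G.graph.Adj x y →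
      ¬ G.graph.Adj x' y := hG.not_adj_of_not_hasThreeCross hcl hS h h'
  -- Cliques have at least three elements.
  have three : ∃ y₁ y₂, G.Near y y₁ ∧ G.Near y y₂ ∧ y₁ ≠ y ∧ y₂ ≠ y ∧ y₁ ≠ y₂ := by
    obtain ⟨u, u', v, v', hu, hv, hcu, hcv, h1, h2, h3, h4⟩ :=
      exists_color_of_crossCompl h' hxy.symm
    obtain ⟨u'', hu'', h5⟩ := (hS v u (by rw [hcu, hcv]; exact hxy)).1
    obtain ⟨φ, hφ⟩ := hG.exists_iso (fun _ : Unit => u) (fun _ => y) (fun _ => hcu)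
      (by simp) (by simp)
    have hφ : φ.toIso u = y := hφ ()
    have e1 : u' ≠ u := by rintro rfl; exact h2 h4
    have e2 : u'' ≠ u := by rintro rfl; exact h1 h5.symm
    have e3 : u' ≠ u'' := by rintro rfl; exact h3 h5.symm
    refine ⟨φ.toIso u', φ.toIso u'', ?_, ?_, ?_, ?_, φ.toIso.injective.ne e3⟩
    · rwa [← hφ, φ.near_iff]
    · rwa [← hφ, φ.near_iff]
    · rw [← hφ]
      exact φ.toIso.injective.ne e1
    · rw [← hφ]
      exact φ.toIso.injective.ne e2
  by_contra hnear
  obtain ⟨⟨x₁, hx₁, ax⟩, -⟩ := hS y x hxy.symm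
  have hzy : G.color z ≠ G.color y := hxz ▸ hxy
  obtain ⟨⟨z₁, hz₁, az⟩, z₂, hz₂, nz⟩ := hS y z hzy.symm
  have ax := ax.symm
  have az := az.symm
  have nz : ¬ G.graph.Adj z₂ y := fun h => nz h.symm
  have hxz' : ∀ {w}, G.Near z w → ¬ G.Near x₁ w := fun hw h =>
    hnear ((hx₁.trans hcl h).trans hcl hw.symm)
  have hx₁y : G.color x₁ ≠ G.color y := hx₁.1 ▸ hxy
  have hz₁y : G.color z₁ ≠ G.color y := hz₁.1 ▸ hzy
  have hz₂y : G.color z₂ ≠ G.color y := hz₂.1 ▸ hzy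
  have hcol : ∀ {w}, G.Near z w → G.color x₁ = G.color w := fun hw =>
    hx₁.1.symm.trans (hxz.trans hw.1)
  have nadj : ∀ {w}, G.Near z w → ¬ G.graph.Adj x₁ w := fun hw h =>
    hxz' hw ⟨hcol hw, Or.inr h⟩
  have hne : ∀ {w}, G.Near z w → x₁ ≠ w := fun hw h =>
    hxz' hw (h ▸ Near.refl x₁)
  -- A vertex `w` of the clique of `y` that is matched to none of the three vertices considered.
  obtain ⟨w, hw, hwy, hwz⟩ : ∃ w, G.Near y w ∧ w ≠ y ∧ ¬ G.graph.Adj z₂ w := by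
    obtain ⟨y₁, y₂, h1, h2, n1, n2, n12⟩ := three
    by_cases hy₁ : G.graph.Adj z₂ y₁
    · exact ⟨y₂, h2, n2, fun hy₂ => no11 (h1.symm.trans hcl h2) n12
        (by rw [← h1.1]; exact hz₂y.symm) hy₁.symm hy₂.symm⟩
    · exact ⟨y₁, h1, n1, hy₁⟩
  have hwx : ¬ G.graph.Adj x₁ w := fun h => no11 hw hwy.symm hx₁y.symm ax.symm h.symm
  have hwz₁ : ¬ G.graph.Adj z₁ w := fun h => no11 hw hwy.symm hz₁y.symm az.symm h.symm
  obtain ⟨φ, h1, h2, h3⟩ := hG.exists_iso_triple (x₁ := x₁) (x₂ := z₁) (y := w) (x₁' := x₁)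
    (x₂' := z₂) (y' := w) rfl (hz₁.1.symm.trans hz₂.1) rfl (by rwa [← hw.1]) (by rwa [← hw.1])
    (hne hz₁) (hne hz₂) (iff_of_false (nadj hz₁) (nadj hz₂)) Iff.rfl (iff_of_false hwz₁ hwz)
  have a1 : G.graph.Adj x₁ (φ.toIso y) := by
    rw [← h1, φ.adj_iff]
    exact ax
  have a2 : G.graph.Adj z₂ (φ.toIso y) := by
    rw [← h2, φ.adj_iff]
    exact az
  have a3 : G.Near y (φ.toIso y) := by
    refine hw.trans hcl ?_
    have := φ.near_iff.2 hw
    rw [h3] at this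
    exact this.symm
  have a4 : y = φ.toIso y := by
    by_contra hne'
    exact no11 a3 hne' hx₁y.symm ax.symm a1.symm
  rw [← a4] at a2
  exact nz a2

/-! ### Cliques of size two -/

/-- In a piecewise ultrahomogeneous graph in which the number of cross edges among two pairs of
vertices is always even, distinct vertices of one clique have complementary neighbourhoods in the
other colour class. -/
theorem PiecewiseUltrahomogeneous.adj_iff_not_adj (hP : G.PiecewiseUltrahomogeneous)
    (hcl : ∀ c, G.IsCliqueUnion c) (hS : G.Splits) (h : ¬ G.HasThreeCross)
    (h' : ¬ G.crossCompl.HasThreeCross) {x x' y : V} (hx : G.Near x x')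
    (hne : x ≠ x') (hxy : G.color x ≠ G.color y) : G.graph.Adj x y ↔ ¬ G.graph.Adj x' y := by
  have h1 : ∀ x x' y y', G.Near x x' → G.Near y y' → G.color x ≠ G.color y → G.graph.Adj x y →
      G.graph.Adj x y' → G.graph.Adj x' y → G.graph.Adj x' y' := by
    intro x x' y y' hx hy hxy a1 a2 a3
    by_contra a4
    exact h ⟨x, x', y, y', hx, hy, hxy, a1, a2, a3, a4⟩
  have h2 : ∀ x x' y y', G.Near x x' → G.Near y y' → G.color x ≠ G.color y →
      ¬ G.graph.Adj x y → ¬ G.graph.Adj x y' → ¬ G.graph.Adj x' y → ¬ G.graph.Adj x' y' := by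
    intro x x' y y' hx hy hxy a1 a2 a3 a4
    exact h' (hasThreeCross_crossCompl_iff.2 ⟨x, x', y, y', hx, hy, hxy, a1, a2, a3, a4⟩)
  by_contra hcon
  have hcon : G.graph.Adj x y ↔ G.graph.Adj x' y := by tauto
  obtain ⟨x'', hx'', ha⟩ : ∃ x'', G.Near x x'' ∧ ¬ (G.graph.Adj x y ↔ G.graph.Adj x'' y) := by
    obtain ⟨⟨x₁, hx₁, a1⟩, x₂, hx₂, a2⟩ := hS y x hxy.symm
    by_cases hadj : G.graph.Adj x y
    · exact ⟨x₂, hx₂, fun h => a2 (h.1 hadj).symm⟩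
    · exact ⟨x₁, hx₁, fun h => hadj (h.2 a1.symm)⟩
  have hne' : x ≠ x'' := by
    rintro rfl
    exact ha Iff.rfl
  obtain ⟨v, hv, e1, e2⟩ := hP.exists_perm hcl hxy (Near.refl x) hx (Near.refl x) hx''
    (iff_of_false hne hne') (Near.refl y)
  have hxy' : G.color x' ≠ G.color y := hx.1 ▸ hxy
  have hxv : G.color x ≠ G.color v := hv.1 ▸ hxy
  have hxv' : G.color x' ≠ G.color v := hv.1 ▸ hxy'
  have p1 := h1 x x' y v hx hv hxy
  have p2 := h1 x' x y v hx.symm hv hxy'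
  have p3 := h1 x x' v y hx hv.symm hxv
  have p4 := h1 x' x v y hx.symm hv.symm hxv'
  have q1 := h2 x x' y v hx hv hxy
  have q2 := h2 x' x y v hx.symm hv hxy'
  have q3 := h2 x x' v y hx hv.symm hxv
  have q4 := h2 x' x v y hx.symm hv.symm hxv'
  clear h1 h2 hS hcl hP h h'
  grind

/-! ### Generic pairs of cliques -/

/-- Over two vertices of one clique, all four adjacency types occur in every clique of the other
colour. -/
def AllTypes (G : TwoColoredGraph V) : Prop :=
  ∀ y y' x, G.Near y y' → y ≠ y' → G.color y ≠ G.color x → ∀ P P' : Prop,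
    ∃ z, G.Near x z ∧ (G.graph.Adj y z ↔ P) ∧ (G.graph.Adj y' z ↔ P')

theorem AllTypes.crossCompl (h : G.AllTypes) : G.crossCompl.AllTypes := by
  intro y y' x hy hne hyx P P'
  rw [crossCompl_near] at hy
  have hyx : G.color y ≠ G.color x := hyx
  obtain ⟨z, hz, h1, h2⟩ := h y y' x hy hne hyx (¬ P) (¬ P')
  refine ⟨z, crossCompl_near.2 hz, ?_, ?_⟩
  · rw [crossCompl_adj_of_ne (by rwa [← hz.1]), h1, not_not]
  · rw [crossCompl_adj_of_ne (by rwa [← hz.1, ← hy.1]), h2, not_not]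

theorem Ultrahomogeneous.allTypes (hG : G.Ultrahomogeneous) (hcl : ∀ c, G.IsCliqueUnion c)
    (h : G.HasThreeCross) (h' : G.crossCompl.HasThreeCross) : G.AllTypes := by
  intro x x' y hx hne hxy
  obtain ⟨x₀, x₀', y₀, y₀', hx₀, hy₀, hcx, hcy, h1, h2, h3, h4⟩ := h.exists_color hxy
  obtain ⟨u, u', v, v', hu, hv, hcu, hcv, k1, k2, k3, k4⟩ := exists_color_of_crossCompl h' hxy
  have n₀ : x₀ ≠ x₀' := by rintro rfl; exact h4 h2
  have n₁ : u ≠ u' := by rintro rfl; exact k2 k4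
  have hxy' : G.color x' ≠ G.color y := hx.1 ▸ hxy
  have hcx' := hcx.trans hx.1
  have hcu' := hcu.trans hx.1
  -- From a vertex of either type of a configuration one gets a vertex of the other type.
  have s11 : ∀ w, G.Near y w → G.graph.Adj x w → G.graph.Adj x' w →
      (∃ z, G.Near y z ∧ G.graph.Adj x z ∧ ¬ G.graph.Adj x' z) ∧
      ∃ z, G.Near y z ∧ ¬ G.graph.Adj x z ∧ G.graph.Adj x' z := by
    intro w hw a a'
    obtain ⟨z, hz, z1, z2⟩ := hG.transfer hx₀ n₀ hy₀ hx hne hcx (hcy.trans hw.1) (hw.1 ▸ hxy)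
      (iff_of_true h1 a) (iff_of_true h3 a')
    obtain ⟨z', hz', z1', z2'⟩ := hG.transfer hx₀ n₀ hy₀ hx.symm hne.symm hcx' (hcy.trans hw.1)
      (hw.1 ▸ hxy') (iff_of_true h1 a') (iff_of_true h3 a)
    exact ⟨⟨z, hw.trans hcl hz, z1.2 h2, fun h => h4 (z2.1 h)⟩,
      z', hw.trans hcl hz', fun h => h4 (z2'.1 h), z1'.2 h2⟩
  have s10 : ∀ w, G.Near y w → G.graph.Adj x w → ¬ G.graph.Adj x' w →
      (∃ z, G.Near y z ∧ G.graph.Adj x z ∧ G.graph.Adj x' z) ∧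
      ∃ z, G.Near y z ∧ ¬ G.graph.Adj x z ∧ ¬ G.graph.Adj x' z := by
    intro w hw a a'
    obtain ⟨z, hz, z1, z2⟩ := hG.transfer hx₀ n₀ hy₀.symm hx hne hcx
      (hy₀.1.symm.trans (hcy.trans hw.1)) (hw.1 ▸ hxy) (iff_of_true h2 a) (iff_of_false h4 a')
    obtain ⟨z', hz', z1', z2'⟩ := hG.transfer hu n₁ hv.symm hx.symm hne.symm hcu'
      (hv.1.symm.trans (hcv.trans hw.1)) (hw.1 ▸ hxy') (iff_of_false k2 a') (iff_of_true k4 a)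
    exact ⟨⟨z, hw.trans hcl hz, z1.2 h1, z2.2 h3⟩,
      z', hw.trans hcl hz', fun h => k3 (z2'.1 h), fun h => k1 (z1'.1 h)⟩
  have s01 : ∀ w, G.Near y w → ¬ G.graph.Adj x w → G.graph.Adj x' w →
      ∃ z, G.Near y z ∧ G.graph.Adj x z ∧ G.graph.Adj x' z := by
    intro w hw a a'
    obtain ⟨z, hz, z1, z2⟩ := hG.transfer hx₀ n₀ hy₀.symm hx.symm hne.symm hcx'
      (hy₀.1.symm.trans (hcy.trans hw.1)) (hw.1 ▸ hxy') (iff_of_true h2 a') (iff_of_false h4 a)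
    exact ⟨z, hw.trans hcl hz, z2.2 h3, z1.2 h1⟩
  have s00 : ∀ w, G.Near y w → ¬ G.graph.Adj x w → ¬ G.graph.Adj x' w →
      ∃ z, G.Near y z ∧ ¬ G.graph.Adj x z ∧ G.graph.Adj x' z := by
    intro w hw a a'
    obtain ⟨z, hz, z1, z2⟩ := hG.transfer hu n₁ hv hx hne hcu (hcv.trans hw.1) (hw.1 ▸ hxy)
      (iff_of_false k1 a) (iff_of_false k3 a')
    exact ⟨z, hw.trans hcl hz, fun h => k2 (z1.1 h), z2.2 k4⟩
  have t11 : ∃ z, G.Near y z ∧ G.graph.Adj x z ∧ G.graph.Adj x' z := by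
    by_cases a : G.graph.Adj x y <;> by_cases a' : G.graph.Adj x' y
    · exact ⟨y, Near.refl y, a, a'⟩
    · exact (s10 y (Near.refl y) a a').1
    · exact s01 y (Near.refl y) a a'
    · obtain ⟨z, hz, b, b'⟩ := s00 y (Near.refl y) a a'
      exact s01 z hz b b'
  obtain ⟨a, ha, a1, a2⟩ := t11
  obtain ⟨⟨b, hb, b1, b2⟩, c, hc, c1, c2⟩ := s11 a ha a1 a2
  obtain ⟨d, hd, d1, d2⟩ := (s10 b hb b1 b2).2
  intro P P'
  by_cases hP : P <;> by_cases hP' : P'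
  · exact ⟨a, ha, iff_of_true a1 hP, iff_of_true a2 hP'⟩
  · exact ⟨b, hb, iff_of_true b1 hP, iff_of_false b2 hP'⟩
  · exact ⟨c, hc, iff_of_false c1 hP, iff_of_true c2 hP'⟩
  · exact ⟨d, hd, iff_of_false d1 hP, iff_of_false d2 hP'⟩

/-- Any two pairs of vertices of one clique can be moved to each other by an automorphism that
preserves a given clique of the other colour. -/
theorem AllTypes.exists_iso (h4 : G.AllTypes) (hG : G.Ultrahomogeneous)
    (hcl : ∀ c, G.IsCliqueUnion c) {x y y' w w' : V} (hy : G.Near y y') (hne : y ≠ y')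
    (hw : G.Near w w') (hne' : w ≠ w') (hyw : G.color y = G.color w)
    (hyx : G.color y ≠ G.color x) :
    ∃ φ : Iso G G, φ.toIso y = w ∧ φ.toIso y' = w' ∧
      ∀ z, G.Near x (φ.toIso z) ↔ G.Near x z := by
  obtain ⟨a, ha, a1, a2⟩ := h4 y y' x hy hne hyx True True
  obtain ⟨b, hb, b1, b2⟩ := h4 w w' x hw hne' (hyw ▸ hyx) True True
  obtain ⟨φ, h1, h2, h3⟩ := hG.exists_iso_triple hyw (hy.1.symm.trans (hyw.trans hw.1))
    (ha.1.symm.trans hb.1) (by rwa [← ha.1]) (by rwa [← ha.1, ← hy.1]) hne hne'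
    (iff_of_true (hy.adj hne) (hw.adj hne')) (a1.trans b1.symm) (a2.trans b2.symm)
  refine ⟨φ, h1, h2, fun z => ?_⟩
  have hab : G.Near x a ↔ G.Near x b := iff_of_true ha hb
  constructor
  · intro h
    exact ha.trans hcl (φ.near_iff.1 (h3.symm ▸ hb.symm.trans hcl h))
  · intro h
    exact hb.trans hcl (h3 ▸ φ.near_iff.2 (ha.symm.trans hcl h))

/-- The vertices in the clique of `x` whose adjacencies to `y` and `y'` are prescribed by the truth
values `P` and `P'`. -/
def typeSet (G : TwoColoredGraph V) (x y y' : V) (P P' : Prop) : Set V :=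
  {z | G.Near x z ∧ (G.graph.Adj y z ↔ P) ∧ (G.graph.Adj y' z ↔ P')}

theorem Iso.image_typeSet (φ : Iso G G) {x : V} (hx : ∀ z, G.Near x (φ.toIso z) ↔ G.Near x z)
    (y y' : V) (P P' : Prop) :
    G.typeSet x (φ.toIso y) (φ.toIso y') P P' = φ.toIso '' G.typeSet x y y' P P' := by
  ext z
  obtain ⟨w, rfl⟩ := φ.exists_preimage z
  rw [φ.toIso.injective.mem_set_image]
  simp [typeSet, hx, φ.adj_iff]

/-- An automorphism fixing `y` that permutes a finite subset of a clique of the other colour in a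
prescribed way. -/
theorem Ultrahomogeneous.exists_iso_perm (hG : G.Ultrahomogeneous)
    (hcl : ∀ c, G.IsCliqueUnion c) {x y : V} (hyx : G.color y ≠ G.color x) {F : Set V}
    (hF : F.Finite) (hne : F.Nonempty) (π : Equiv.Perm V) (h₁ : ∀ z ∈ F, G.Near x z)
    (h₂ : ∀ z ∈ F, G.Near x (π z)) (h₃ : ∀ z ∈ F, G.graph.Adj y (π z) ↔ G.graph.Adj y z) :
    ∃ φ : Iso G G, φ.toIso y = y ∧ (∀ z ∈ F, φ.toIso z = π z) ∧
      ∀ z, G.Near x (φ.toIso z) ↔ G.Near x z := by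
  have := hF.to_subtype
  obtain ⟨φ, h1, h2⟩ := hG.exists_iso_cone hcl (s := fun z : F => (z : V))
    (t := fun z : F => π z) Subtype.val_injective (π.injective.comp Subtype.val_injective)
    (x := x) (x' := x) (y := y) (y' := y) (fun z => h₁ z z.2) (fun z => h₂ z z.2) rfl rfl hyx.symm
    (fun z => by rw [G.graph.adj_comm, ← h₃ z z.2, G.graph.adj_comm])
  refine ⟨φ, h2, fun z hz => h1 ⟨z, hz⟩, fun z => ?_⟩
  obtain ⟨a, ha⟩ := hne
  have hφa : G.Near x (φ.toIso a) := by
    rw [h1 ⟨a, ha⟩]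
    exact h₂ a ha
  constructor
  · intro h
    exact (h₁ a ha).trans hcl (φ.near_iff.1 (hφa.symm.trans hcl h))
  · intro h
    exact hφa.trans hcl (φ.near_iff.2 ((h₁ a ha).symm.trans hcl h))

/-- Two vertices of one clique have infinitely many common neighbours in each clique of the other
colour. Otherwise, this number `α` is the same for all such pairs. Moving `y'` by automorphisms that
fix `y` and swap vertices within the neighbourhood and within the non-neighbourhood of `y` gives
vertices near `y'`. A swap outside the neighbourhood of `y` can be chosen to leave more than `α`
common neighbours with `y'`, unless `y'` has only one neighbour `q` that is not adjacent to `y`. In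
that case, moving `q` and a common neighbour `p` of `y` and `y'` leaves fewer than `α`. -/
theorem AllTypes.infinite_typeSet_true_true (h4 : G.AllTypes) (hG : G.Ultrahomogeneous)
    (hcl : ∀ c, G.IsCliqueUnion c) {x y y' : V} (hy : G.Near y y') (hne : y ≠ y')
    (hyx : G.color y ≠ G.color x) : (G.typeSet x y y' True True).Infinite := by
  classical
  intro hfin
  set A := G.typeSet x y y' True True with hA
  have hcard : ∀ w w', G.Near w w' → w ≠ w' → G.color y = G.color w →
      (G.typeSet x w w' True True).Finite ∧ (G.typeSet x w w' True True).ncard = A.ncard := by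
    intro w w' hw hww hyw
    obtain ⟨φ, rfl, rfl, h3⟩ := h4.exists_iso hG hcl hy hne hw hww hyw hyx
    rw [φ.image_typeSet h3]
    exact ⟨hfin.image _, Set.ncard_image_of_injective _ φ.toIso.injective⟩
  obtain ⟨p, hp, p1, p2⟩ := h4 y y' x hy hne hyx True True
  obtain ⟨p', hp', p1', p2'⟩ := h4 y y' x hy hne hyx True False
  obtain ⟨q, hq, q1, q2⟩ := h4 y y' x hy hne hyx False True
  obtain ⟨q', hq', q1', q2'⟩ := h4 y y' x hy hne hyx False False
  simp only [iff_true, iff_false] at p1 p2 p1' p2' q1 q2 q1' q2'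
  have mem : ∀ {z}, z ∈ A ↔ G.Near x z ∧ G.graph.Adj y z ∧ G.graph.Adj y' z := by
    simp [hA, typeSet]
  have hqA : q ∉ A := fun h => q1 (mem.1 h).2.1
  have huniq : ∀ z, G.Near x z → ¬ G.graph.Adj y z → G.graph.Adj y' z → z = q := by
    intro r hr r1 r2
    by_contra hrq
    have hfix : ∀ z ∈ insert q A, Equiv.swap r q' z = z := by
      rintro z (rfl | hz)
      · exact Equiv.swap_apply_of_ne_of_ne (Ne.symm hrq) (by rintro rfl; exact q2' q2)
      · rw [mem] at hz
        exact Equiv.swap_apply_of_ne_of_ne (by rintro rfl; exact r1 hz.2.1)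
          (by rintro rfl; exact q2' hz.2.2)
    obtain ⟨φ, h1, h2, h3⟩ := hG.exists_iso_perm hcl hyx (F := insert r (insert q A))
      ((hfin.insert _).insert _) ⟨r, by simp⟩ (Equiv.swap r q')
      (by
        rintro z (rfl | rfl | hz)
        exacts [hr, hq, (mem.1 hz).1])
      (by
        rintro z (rfl | hz)
        · rwa [Equiv.swap_apply_left]
        · rw [hfix z hz]
          rcases hz with rfl | hz
          exacts [hq, (mem.1 hz).1])
      (by
        rintro z (rfl | hz)
        · rw [Equiv.swap_apply_left]
          exact iff_of_false q1' r1
        · rw [hfix z hz])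
    have hyy : G.Near y (φ.toIso y') := by
      have := φ.near_iff.2 hy
      rwa [h1] at this
    have hq'' : G.graph.Adj (φ.toIso y') q' := by
      rw [← Equiv.swap_apply_left r q', ← h2 r (by simp), φ.adj_iff]
      exact r2
    have hne' : y' ≠ φ.toIso y' := fun h => q2' (h ▸ hq'')
    obtain ⟨f1, c1⟩ := hcard y' (φ.toIso y') (hy.symm.trans hcl hyy) hne' hy.1
    have hsub : insert q A ⊆ G.typeSet x y' (φ.toIso y') True True := by
      intro z hz
      have hz2 : G.Near x z ∧ G.graph.Adj y' z := by
        rcases hz with rfl | hz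
        exacts [⟨hq, q2⟩, ⟨(mem.1 hz).1, (mem.1 hz).2.2⟩]
      refine ⟨hz2.1, iff_true_intro hz2.2, iff_true_intro ?_⟩
      rw [← hfix z hz, ← h2 z (Set.mem_insert_of_mem _ hz), φ.adj_iff]
      exact hz2.2
    have := Set.ncard_le_ncard hsub f1
    rw [Set.ncard_insert_of_notMem hqA hfin, c1] at this
    omega
  have hpA : p ∈ A := mem.2 ⟨hp, p1, p2⟩
  have npp : p ≠ p' := by rintro rfl; exact p2' p2
  have nqq : q ≠ q' := by rintro rfl; exact q2' q2
  have npq : p ≠ q := by rintro rfl; exact q1 p1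
  have npq' : p ≠ q' := by rintro rfl; exact q1' p1
  have np'q : p' ≠ q := by rintro rfl; exact q1 p1'
  have np'q' : p' ≠ q' := by rintro rfl; exact q1' p1'
  set π : Equiv.Perm V := Equiv.swap p p' * Equiv.swap q q' with hπ
  have πp : π p = p' := by
    rw [hπ, Equiv.Perm.mul_apply, Equiv.swap_apply_of_ne_of_ne npq npq', Equiv.swap_apply_left]
  have πq : π q = q' := by
    rw [hπ, Equiv.Perm.mul_apply, Equiv.swap_apply_left,
      Equiv.swap_apply_of_ne_of_ne npq'.symm np'q'.symm]
  have πA : ∀ z ∈ A, z ≠ p → π z = z := by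
    intro z hz hzp
    rw [mem] at hz
    have hzq : z ≠ q := by rintro rfl; exact q1 hz.2.1
    have hzq' : z ≠ q' := by rintro rfl; exact q1' hz.2.1
    have hzp' : z ≠ p' := by rintro rfl; exact p2' hz.2.2
    rw [hπ, Equiv.Perm.mul_apply, Equiv.swap_apply_of_ne_of_ne hzq hzq',
      Equiv.swap_apply_of_ne_of_ne hzp hzp']
  obtain ⟨φ, h1, h2, h3⟩ := hG.exists_iso_perm hcl hyx (F := insert q A)
    (hfin.insert _) ⟨q, by simp⟩ π
    (by
      rintro z (rfl | hz)
      exacts [hq, (mem.1 hz).1])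
    (by
      rintro z (rfl | hz)
      · rwa [πq]
      · by_cases hzp : z = p
        · rwa [hzp, πp]
        · rw [πA z hz hzp]
          exact (mem.1 hz).1)
    (by
      rintro z (rfl | hz)
      · rw [πq]
        exact iff_of_false q1' q1
      · by_cases hzp : z = p
        · rw [hzp, πp]
          exact iff_of_true p1' p1
        · rw [πA z hz hzp])
  have hyy : G.Near y (φ.toIso y') := by
    have := φ.near_iff.2 hy
    rwa [h1] at this
  -- The neighbours of `y'` in the clique of `x` are `q` and the elements of `A`, and `φ` maps
  -- none of them to `p` or `q`.
  have hpre : ∀ z, G.Near x z → G.graph.Adj (φ.toIso y') z → z ≠ p ∧ z ≠ q := by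
    intro z hz hyz
    obtain ⟨w, rfl⟩ := φ.exists_preimage z
    rw [h3] at hz
    rw [φ.adj_iff] at hyz
    have hw : w ∈ insert q A := by
      by_cases hyw : G.graph.Adj y w
      · exact Or.inr (mem.2 ⟨hz, hyw, hyz⟩)
      · exact Or.inl (huniq w hz hyw hyz)
    rw [h2 w hw]
    rcases hw with rfl | hw
    · rw [πq]
      exact ⟨npq'.symm, nqq.symm⟩
    · by_cases hwp : w = p
      · rw [hwp, πp]
        exact ⟨npp.symm, np'q⟩
      · rw [πA w hw hwp]
        exact ⟨hwp, fun h => hqA (h ▸ hw)⟩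
  have hne' : y' ≠ φ.toIso y' := fun h => (hpre p hp (h ▸ p2)).1 rfl
  obtain ⟨f1, c1⟩ := hcard y' (φ.toIso y') (hy.symm.trans hcl hyy) hne' hy.1
  have hsub : G.typeSet x y' (φ.toIso y') True True ⊆ A \ {p} := by
    rintro z ⟨hz, z1, z2⟩
    have hz' := hpre z hz (z2.2 trivial)
    refine ⟨mem.2 ⟨hz, ?_, z1.2 trivial⟩, hz'.1⟩
    by_contra hyz
    exact hz'.2 (huniq z hz hyz (z1.2 trivial))
  have := Set.ncard_le_ncard hsub hfin.sdiff
  have := Set.ncard_sdiff_singleton_lt_of_mem hpA hfin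
  omega

/-- The analogue of `AllTypes.infinite_typeSet_true_true` for the vertices adjacent to exactly one
of two given vertices, with the same proof idea. -/
theorem AllTypes.infinite_typeSet_false_true (h4 : G.AllTypes) (hG : G.Ultrahomogeneous)
    (hcl : ∀ c, G.IsCliqueUnion c) {x y y' : V} (hy : G.Near y y') (hne : y ≠ y')
    (hyx : G.color y ≠ G.color x) : (G.typeSet x y y' False True).Infinite := by
  classical
  intro hfin
  set A := G.typeSet x y y' False True with hA
  have hcard : ∀ w w', G.Near w w' → w ≠ w' → G.color y = G.color w →
      (G.typeSet x w w' False True).Finite ∧ (G.typeSet x w w' False True).ncard = A.ncard := by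
    intro w w' hw hww hyw
    obtain ⟨φ, rfl, rfl, h3⟩ := h4.exists_iso hG hcl hy hne hw hww hyw hyx
    rw [φ.image_typeSet h3]
    exact ⟨hfin.image _, Set.ncard_image_of_injective _ φ.toIso.injective⟩
  set C := G.typeSet x y' y False True with hC
  have hCfin : C.Finite := (hcard y' y hy.symm hne.symm hy.1).1
  obtain ⟨p, hp, p1, p2⟩ := h4 y y' x hy hne hyx True True
  obtain ⟨c, hc, c1, c2⟩ := h4 y y' x hy hne hyx True False
  obtain ⟨q, hq, q1, q2⟩ := h4 y y' x hy hne hyx False True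
  obtain ⟨q', hq', q1', q2'⟩ := h4 y y' x hy hne hyx False False
  simp only [iff_true, iff_false] at p1 p2 c1 c2 q1 q2 q1' q2'
  have memA : ∀ {z}, z ∈ A ↔ G.Near x z ∧ ¬ G.graph.Adj y z ∧ G.graph.Adj y' z := by
    simp [hA, typeSet]
  have memC : ∀ {z}, z ∈ C ↔ G.Near x z ∧ ¬ G.graph.Adj y' z ∧ G.graph.Adj y z := by
    simp [hC, typeSet]
  have hqA : q ∈ A := memA.2 ⟨hq, q1, q2⟩
  have nqq : q ≠ q' := by rintro rfl; exact q2' q2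
  have npc : p ≠ c := by rintro rfl; exact c2 p2
  have npq : p ≠ q := by rintro rfl; exact q1 p1
  have npq' : p ≠ q' := by rintro rfl; exact q1' p1
  have ncq : c ≠ q := by rintro rfl; exact q1 c1
  have ncq' : c ≠ q' := by rintro rfl; exact q1' c1
  -- Swapping `q` with `q'` only: `y'` and its image differ in `q` and `q'`.
  have hone : A.ncard ≤ 1 := by
    have hfix : ∀ z ∈ A ∪ C, z ≠ q → Equiv.swap q q' z = z := by
      rintro z hz hzq
      refine Equiv.swap_apply_of_ne_of_ne hzq ?_
      rintro rfl
      rcases hz with hz | hz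
      exacts [q2' (memA.1 hz).2.2, q1' (memC.1 hz).2.2]
    have hnear : ∀ z ∈ A ∪ C, G.Near x z := by
      rintro z (hz | hz)
      exacts [(memA.1 hz).1, (memC.1 hz).1]
    obtain ⟨φ, h1, h2, h3⟩ := hG.exists_iso_perm hcl hyx (F := A ∪ C)
      (hfin.union hCfin) ⟨q, Or.inl hqA⟩ (Equiv.swap q q') hnear
      (by
        intro z hz
        by_cases hzq : z = q
        · rwa [hzq, Equiv.swap_apply_left]
        · rw [hfix z hz hzq]
          exact hnear z hz)
      (by
        intro z hz
        by_cases hzq : z = q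
        · rw [hzq, Equiv.swap_apply_left]
          exact iff_of_false q1' q1
        · rw [hfix z hz hzq])
    have hyy : G.Near y (φ.toIso y') := by
      have := φ.near_iff.2 hy
      rwa [h1] at this
    have hq'' : G.graph.Adj (φ.toIso y') q' := by
      rw [← Equiv.swap_apply_left q q', ← h2 q (Or.inl hqA), φ.adj_iff]
      exact q2
    have hne' : y' ≠ φ.toIso y' := fun h => q2' (h ▸ hq'')
    obtain ⟨f1, e1⟩ := hcard y' (φ.toIso y') (hy.symm.trans hcl hyy) hne' hy.1
    have hsub : G.typeSet x y' (φ.toIso y') False True ⊆ {q'} := by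
      rintro z ⟨hz, z1, z2⟩
      simp only [iff_true, iff_false] at z1 z2
      obtain ⟨w, rfl⟩ := φ.exists_preimage z
      rw [h3] at hz
      rw [φ.adj_iff] at z2
      by_cases hyw : G.graph.Adj y w
      · have hyw' : G.graph.Adj y (φ.toIso w) := by rwa [← h1, φ.adj_iff]
        have hmem : φ.toIso w ∈ C := memC.2 ⟨(h3 w).2 hz, z1, hyw'⟩
        have hfw : φ.toIso (φ.toIso w) = φ.toIso w := by
          rw [h2 _ (Or.inr hmem)]
          exact hfix _ (Or.inr hmem) fun h => q1 (h ▸ hyw')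
        rw [φ.toIso.injective hfw] at z1
        exact absurd z2 z1
      · have hw : w ∈ A := memA.2 ⟨hz, hyw, z2⟩
        rw [h2 w (Or.inl hw)] at z1 ⊢
        by_cases hwq : w = q
        · rw [hwq, Equiv.swap_apply_left]
          rfl
        · rw [hfix w (Or.inl hw) hwq] at z1
          exact absurd z2 z1
    have := Set.ncard_le_ncard hsub (Set.finite_singleton _)
    rwa [e1, Set.ncard_singleton] at this
  -- Swapping also `c` with `p`, the image of `y'` but not `y'` itself is adjacent to `q'` and `c`.
  set π : Equiv.Perm V := Equiv.swap c p * Equiv.swap q q' with hπ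
  have πc : π c = p := by
    rw [hπ, Equiv.Perm.mul_apply, Equiv.swap_apply_of_ne_of_ne ncq ncq', Equiv.swap_apply_left]
  have πq : π q = q' := by
    rw [hπ, Equiv.Perm.mul_apply, Equiv.swap_apply_left,
      Equiv.swap_apply_of_ne_of_ne ncq'.symm npq'.symm]
  have πfix : ∀ z ∈ insert q C, z ≠ q → z ≠ c → π z = z := by
    rintro z (rfl | hz) hzq hzc
    · exact absurd rfl hzq
    rw [memC] at hz
    have hzq' : z ≠ q' := by rintro rfl; exact q1' hz.2.2
    have hzp : z ≠ p := by rintro rfl; exact hz.2.1 p2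
    rw [hπ, Equiv.Perm.mul_apply, Equiv.swap_apply_of_ne_of_ne hzq hzq',
      Equiv.swap_apply_of_ne_of_ne hzc hzp]
  have hnear : ∀ z ∈ insert q C, G.Near x z := by
    rintro z (rfl | hz)
    exacts [hq, (memC.1 hz).1]
  obtain ⟨φ, h1, h2, h3⟩ := hG.exists_iso_perm hcl hyx (F := insert q C)
    (hCfin.insert _) ⟨q, by simp⟩ π hnear
    (by
      intro z hz
      by_cases hzq : z = q
      · rwa [hzq, πq]
      by_cases hzc : z = c
      · rwa [hzc, πc]
      rw [πfix z hz hzq hzc]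
      exact hnear z hz)
    (by
      intro z hz
      by_cases hzq : z = q
      · rw [hzq, πq]
        exact iff_of_false q1' q1
      by_cases hzc : z = c
      · rw [hzc, πc]
        exact iff_of_true p1 c1
      rw [πfix z hz hzq hzc])
  have hyy : G.Near y (φ.toIso y') := by
    have := φ.near_iff.2 hy
    rwa [h1] at this
  have hq'' : G.graph.Adj (φ.toIso y') q' := by
    rw [← πq, ← h2 q (by simp), φ.adj_iff]
    exact q2
  have hne' : y' ≠ φ.toIso y' := fun h => q2' (h ▸ hq'')
  obtain ⟨f1, e1⟩ := hcard y' (φ.toIso y') (hy.symm.trans hcl hyy) hne' hy.1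
  have hc'' : G.graph.Adj (φ.toIso y') c := by
    obtain ⟨w, hw⟩ := φ.exists_preimage c
    have hwx : G.Near x w := by rwa [← h3, hw]
    have hyw : G.graph.Adj y w := by rwa [← φ.adj_iff, h1, hw]
    rw [← hw, φ.adj_iff]
    by_contra hyw'
    have hwC : w ∈ insert q C := Or.inr (memC.2 ⟨hwx, hyw', hyw⟩)
    have hπw := h2 w hwC
    rw [hw] at hπw
    by_cases hwc : w = c
    · rw [hwc, πc] at hπw
      exact npc hπw.symm
    · rw [πfix w hwC (by rintro rfl; exact q1 hyw) hwc] at hπw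
      exact hwc hπw.symm
  have hsub : {q', c} ⊆ G.typeSet x y' (φ.toIso y') False True := by
    rintro z (rfl | rfl)
    · exact ⟨hq', iff_false_intro q2', iff_true_intro hq''⟩
    · exact ⟨hc, iff_false_intro c2, iff_true_intro hc''⟩
  have := Set.ncard_le_ncard hsub f1
  rw [Set.ncard_pair ncq'.symm] at this
  omega

theorem AllTypes.infinite_typeSet (h4 : G.AllTypes) (hG : G.Ultrahomogeneous)
    (hcl : ∀ c, G.IsCliqueUnion c) {x y y' : V} (hy : G.Near y y') (hne : y ≠ y')
    (hyx : G.color y ≠ G.color x) (P P' : Prop) : (G.typeSet x y y' P P').Infinite := by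
  by_cases hP : P <;> by_cases hP' : P' <;> simp only [hP, hP']
  · exact h4.infinite_typeSet_true_true hG hcl hy hne hyx
  · refine (h4.infinite_typeSet_false_true hG hcl hy.symm hne.symm (hy.1 ▸ hyx)).mono ?_
    exact fun z hz => ⟨hz.1, hz.2.2, hz.2.1⟩
  · exact h4.infinite_typeSet_false_true hG hcl hy hne hyx
  · refine (h4.crossCompl.infinite_typeSet_true_true hG.crossCompl
      (crossCompl_isCliqueUnion hcl) (crossCompl_near.2 hy) hne hyx).mono ?_
    rintro z ⟨h1, h2, h3⟩
    rw [crossCompl_near] at h1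
    rw [crossCompl_adj_of_ne (by rwa [← h1.1])] at h2
    rw [crossCompl_adj_of_ne (by rwa [← h1.1, ← hy.1])] at h3
    exact ⟨h1, by simpa using h2, by simpa using h3⟩

theorem exists_injOn_mem_of_infinite {ι α : Type*} (A : ι → Set α) (hA : ∀ i, (A i).Infinite)
    (s : Finset ι) : ∃ u : ι → α, Set.InjOn u s ∧ ∀ i, u i ∈ A i := by
  classical
  induction s using Finset.induction_on with
  | empty => exact ⟨fun i => (hA i).nonempty.some, by simp, fun i => (hA i).nonempty.some_mem⟩
  | insert a s ha ih =>
    obtain ⟨u, hu, huA⟩ := ih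
    obtain ⟨b, hb, hbs⟩ := (hA a).exists_notMem_finset (s.image u)
    refine ⟨Function.update u a b, ?_, fun i => ?_⟩
    · rw [Finset.coe_insert, Set.injOn_insert (by simpa using ha)]
      have heq : ∀ i ∈ s, Function.update u a b i = u i := fun i hi =>
        Function.update_of_ne (by rintro rfl; exact ha hi) _ _
      refine ⟨fun i hi j hj hij => hu hi hj ?_, ?_⟩
      · rwa [heq i hi, heq j hj] at hij
      · rintro ⟨i, hi, hi'⟩
        rw [heq i hi, Function.update_self] at hi'
        exact hbs (Finset.mem_image.2 ⟨i, hi, hi'⟩)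
    · by_cases hi : i = a
      · subst hi
        simpa using hb
      · simpa [hi] using huA i

theorem Ultrahomogeneous.exists_near_ne (hG : G.Ultrahomogeneous)
    (hpair : ∀ c, ∃ a b, G.color a = c ∧ G.Near a b ∧ a ≠ b) (y : V) :
    ∃ y', G.Near y y' ∧ y ≠ y' := by
  obtain ⟨a, b, ha, hab, hne⟩ := hpair (G.color y)
  obtain ⟨φ, hφ⟩ := hG.exists_iso (fun _ : Unit => a) (fun _ => y) (fun _ => ha)
    (by simp) (by simp)
  rw [← hφ ()]
  exact ⟨φ.toIso b, φ.near_iff.2 hab, φ.toIso.injective.ne hne⟩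

/-- If all types over pairs occur, then `G` is piecewise ultrahomogeneous: the infinite
multiplicity of types over pairs `(y, y₀)` gives, for any two adjacency patterns, vertices
realizing them over a common tuple. -/
theorem AllTypes.piecewise {V : Type u} {G : TwoColoredGraph V} (h4 : G.AllTypes)
    (hG : G.Ultrahomogeneous) (hcl : ∀ c, G.IsCliqueUnion c)
    (hpair : ∀ c, ∃ a b, G.color a = c ∧ G.Near a b ∧ a ≠ b) : G.PiecewiseUltrahomogeneous := by
  refine hG.piecewise hcl (fun c => ?_) ?_
  · obtain ⟨a, -, ha, -⟩ := hpair c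
    exact ⟨a, ha⟩
  intro x y hxy ι _ _ s t hs ht hxs hxt
  obtain ⟨y₀, hy₀, hne⟩ := hG.exists_near_ne hpair y
  have := Fintype.ofFinite ι
  obtain ⟨u, hu, huA⟩ := exists_injOn_mem_of_infinite
    (fun i => G.typeSet x y y₀ (G.graph.Adj (t i) y) (G.graph.Adj (s i) y))
    (fun i => h4.infinite_typeSet hG hcl hy₀ hne hxy.symm _ _) Finset.univ
  rw [Finset.coe_univ, Set.injOn_univ] at hu
  obtain ⟨φ, h1, h2⟩ := hG.exists_iso_cone hcl hu ht (x := x) (x' := x) (y := y) (y' := y)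
    (fun i => (huA i).1) hxt rfl rfl hxy (fun i => by rw [G.graph.adj_comm, (huA i).2.1])
  refine ⟨y, φ.toIso y₀, Near.refl y, ?_, fun i => ?_⟩
  · have := φ.near_iff.2 hy₀
    rwa [h2] at this
  · rw [← h1, φ.adj_iff, G.graph.adj_comm (u i), (huA i).2.2]

/-! ### The graph `F_{2,2}` -/

/-- Distinct vertices of one monochromatic clique have complementary neighbourhoods in the other
colour class. -/
def Complementary (G : TwoColoredGraph V) : Prop :=
  ∀ x x' y, G.Near x x' → x ≠ x' → G.color x ≠ G.color y →
    (G.graph.Adj x y ↔ ¬ G.graph.Adj x' y)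

theorem realizes_monoTriangle (c : Color) {x y z : V} (hxc : G.color x = c) (hxy : G.Near x y)
    (hxz : G.Near x z) (h₁ : G.graph.Adj x y) (h₂ : G.graph.Adj y z) (h₃ : G.graph.Adj x z) :
    G.Realizes (monoTriangle c) := by
  have hy := hxy.1.symm.trans hxc
  have hz := hxz.1.symm.trans hxc
  refine realizes_iff.2 ⟨![x, y, z], ?_, ?_, ?_⟩
  · intro i j
    fin_cases i <;> fin_cases j <;> simp [h₁.ne, h₂.ne, h₃.ne, h₁.ne', h₂.ne', h₃.ne']
  · intro i
    fin_cases i <;> simp [monoTriangle, hxc, hy, hz]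
  · intro i j
    fin_cases i <;> fin_cases j <;>
      simp [monoTriangle, h₁, h₂, h₃, h₁.symm, h₂.symm, h₃.symm]

theorem MemClassF22.no_triangle (hG : G.MemClassF22) {x y z : V} (hxy : G.Near x y)
    (hxz : G.Near x z) (h₁ : x ≠ y) (h₂ : x ≠ z) : y = z := by
  by_contra h₃
  exact hG.2.1 _ (realizes_monoTriangle _ rfl hxy hxz (hxy.adj h₁)
    ((hxy.symm.trans hG.1 hxz).adj h₃) (hxz.adj h₂))

theorem realizes_of_triangle {T : TwoColoredGraph (Fin 3)} (hT : T.graph = ⊤)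
    (hT₀ : T.color 0 = T.color 1) {x x' y : V} (hx : G.Near x x') (hne : x ≠ x')
    (hcx : G.color x = T.color 0) (hcy : G.color y = T.color 2) (h : G.graph.Adj x y)
    (h' : G.graph.Adj x' y) : G.Realizes T := by
  have hx' := hx.adj hne
  refine realizes_iff.2 ⟨![x, x', y], ?_, ?_, ?_⟩
  · intro i j
    fin_cases i <;> fin_cases j <;> simp [hne, hne.symm, h.ne, h.ne', h'.ne, h'.ne']
  · intro i
    fin_cases i <;> simp [hcx, hcy, ← hx.1, hT₀]
  · intro i j
    fin_cases i <;> fin_cases j <;> simp [hT, hx', h, h', hx'.symm, h.symm, h'.symm]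

theorem Complementary.not_realizes_triangle (h : G.Complementary) {T : TwoColoredGraph (Fin 3)}
    (hT : T.graph = ⊤) (hT₀ : T.color 0 = T.color 1) (hT₁ : T.color 0 ≠ T.color 2) :
    ¬ G.Realizes T := by
  rw [realizes_iff]
  rintro ⟨f, hf, hc, ha⟩
  have h01 : G.graph.Adj (f 0) (f 1) := by rw [ha, hT]; simp
  have h02 : G.graph.Adj (f 0) (f 2) := by rw [ha, hT]; simp
  have h12 : G.graph.Adj (f 1) (f 2) := by rw [ha, hT]; simp
  exact (h (f 0) (f 1) (f 2) ⟨by rw [hc, hc, hT₀], Or.inr h01⟩ h01.ne (by rwa [hc, hc])).1 h02 h12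

theorem Complementary.crossCompl (h : G.Complementary) : G.crossCompl.Complementary := by
  intro x x' y hx hne hxy
  rw [crossCompl_near] at hx
  have hxy : G.color x ≠ G.color y := hxy
  rw [crossCompl_adj_of_ne hxy, crossCompl_adj_of_ne (by rwa [← hx.1]), h x x' y hx hne hxy]

theorem Complementary.memClassF22 (h : G.Complementary) (hcl : ∀ c, G.IsCliqueUnion c)
    (hne : ∀ c, (G.colorClass c).Nonempty) : G.MemClassF22 := by
  refine ⟨hcl, fun c hc => ?_, h.not_realizes_triangle rfl rfl (by simp [triangleRed]),
    fun hT => ?_, h.not_realizes_triangle rfl rfl (by simp [triangleBlue]), fun hT => ?_⟩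
  · obtain ⟨f, hf, hfc, hfa⟩ := realizes_iff.1 hc
    have near : ∀ i j, G.Near (f i) (f j) := by
      intro i j
      refine ⟨(hfc i).trans (hfc j).symm, ?_⟩
      by_cases hij : i = j
      · exact Or.inl (by rw [hij])
      · exact Or.inr ((hfa i j).2 (by simpa [monoTriangle] using hij))
    obtain ⟨y, hy⟩ : ∃ y, G.color y ≠ c := by
      cases c
      · obtain ⟨y, hy⟩ := hne Color.blue
        exact ⟨y, by rw [show G.color y = Color.blue from hy]; simp⟩
      · obtain ⟨y, hy⟩ := hne Color.red
        exact ⟨y, by rw [show G.color y = Color.red from hy]; simp⟩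
    have hfy : ∀ i, G.color (f i) ≠ G.color y := fun i h => hy (h.symm.trans (hfc i))
    have h1 := h _ _ y (near 0 1) (hf.ne (by decide)) (hfy 0)
    have h2 := h _ _ y (near 1 2) (hf.ne (by decide)) (hfy 1)
    have h3 := h _ _ y (near 0 2) (hf.ne (by decide)) (hfy 0)
    tauto
  · exact h.crossCompl.not_realizes_triangle rfl rfl (by simp [triangleRed])
      (realizes_crossCompl_iff.1 hT)
  · exact h.crossCompl.not_realizes_triangle rfl rfl (by simp [triangleBlue])
      (realizes_crossCompl_iff.1 hT)

theorem MemClassF22.complementary (hG : G.MemClassF22) : G.Complementary := by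
  have key : ∀ (G' : TwoColoredGraph V), ¬ G'.Realizes triangleRed →
      ¬ G'.Realizes triangleBlue → ∀ x x' y, G'.Near x x' → x ≠ x' → G'.color x ≠ G'.color y →
      ¬ (G'.graph.Adj x y ∧ G'.graph.Adj x' y) := by
    rintro G' hr hb x x' y hx hne hxy ⟨h1, h2⟩
    cases hcx : G'.color x
    · have hcy : G'.color y = Color.blue := by
        rw [hcx] at hxy
        cases hcy : G'.color y <;> simp_all
      exact hr (realizes_of_triangle rfl rfl hx hne (by simpa [triangleRed] using hcx)
        (by simpa [triangleRed] using hcy) h1 h2)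
    · have hcy : G'.color y = Color.red := by
        rw [hcx] at hxy
        cases hcy : G'.color y <;> simp_all
      exact hb (realizes_of_triangle rfl rfl hx hne (by simpa [triangleBlue] using hcx)
        (by simpa [triangleBlue] using hcy) h1 h2)
  obtain ⟨-, -, h1, h2, h3, h4⟩ := hG
  rw [realizes_crossCompl_iff] at h2 h4
  intro x x' y hx hne hxy
  have k1 := key G h1 h3 x x' y hx hne hxy
  have k2 := key G.crossCompl h2 h4 x x' y (crossCompl_near.2 hx) hne hxy
  rw [crossCompl_adj_of_ne hxy, crossCompl_adj_of_ne (by rwa [← hx.1])] at k2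
  tauto

theorem MemClassF22.of_realizes (hG : G.MemClassF22) (h : G.Realizes H) : H.MemClassF22 := by
  refine ⟨fun c x hx y hy z hz h1 h2 hne => ?_, fun c hc => hG.2.1 c (h.trans hc),
    fun h' => hG.2.2.1 (h.trans h'), fun h' => hG.2.2.2.1 (h.trans h'),
    fun h' => hG.2.2.2.2.1 (h.trans h'), fun h' => hG.2.2.2.2.2 (h.trans h')⟩
  obtain ⟨f, hf, hfc, hfa⟩ := realizes_iff.1 h
  rw [← hfa] at h1 h2 ⊢
  exact hG.1 c _ ((hfc x).trans hx) _ ((hfc y).trans hy) _ ((hfc z).trans hz) h1 h2 (hf.ne hne)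

theorem IsF22.memClassF22 (hG : G.IsF22) (hcl : ∀ c, G.IsCliqueUnion c) : G.MemClassF22 := by
  have h : ∀ (H : TwoColoredGraph (Fin 3)), G.Realizes H → H.MemClassF22 := fun H => (hG.2.2 3 H).1
  exact ⟨hcl, fun c hc => (h _ hc).2.1 c (realizes_refl _),
    fun h' => (h _ h').2.2.1 (realizes_refl _), fun h' => (h _ h').2.2.2.1 (realizes_refl _),
    fun h' => (h _ h').2.2.2.2.1 (realizes_refl _), fun h' => (h _ h').2.2.2.2.2 (realizes_refl _)⟩

theorem IsF22.exists_pair (hG : G.IsF22) (c : Color) :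
    ∃ a b, G.color a = c ∧ G.Near a b ∧ a ≠ b := by
  let K : TwoColoredGraph (Fin 2) := ⟨⊤, fun _ => c⟩
  have hK : ∀ T : TwoColoredGraph (Fin 3), ¬ K.Realizes T := by
    intro T hT
    obtain ⟨f, hf, -⟩ := realizes_iff.1 hT
    simpa using Fintype.card_le_of_injective f hf
  obtain ⟨f, hf, hfc, hfa⟩ := realizes_iff.1 ((hG.2.2 2 K).2
    ⟨fun _ _ _ _ _ _ _ _ _ hne => hne, fun c => hK _, hK _, hK _, hK _, hK _⟩)
  refine ⟨f 0, f 1, hfc 0, ⟨(hfc 0).trans (hfc 1).symm, Or.inr ?_⟩, hf.ne (by decide)⟩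
  rw [hfa]
  simp [K]

/-- Once the map respects the adjacencies for one vertex of a clique, complementarity makes it
respect them for the others. -/
theorem Complementary.piecewise {V : Type u} {G : TwoColoredGraph V} (h : G.Complementary)
    (hG : G.Ultrahomogeneous) (hcl : ∀ c, G.IsCliqueUnion c)
    (hpair : ∀ c, ∃ a b, G.color a = c ∧ G.Near a b ∧ a ≠ b) : G.PiecewiseUltrahomogeneous := by
  refine hG.piecewise hcl (fun c => ?_) ?_
  · obtain ⟨a, -, ha, -⟩ := hpair c
    exact ⟨a, ha⟩
  intro x y hxy ι _ hι s t hs ht hxs hxt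
  obtain ⟨i₀⟩ := hι
  obtain ⟨y', hy', hne⟩ := hG.exists_near_ne hpair y
  obtain ⟨w, hw, hwi⟩ : ∃ w, G.Near y w ∧ (G.graph.Adj (s i₀) y ↔ G.graph.Adj (t i₀) w) := by
    have := h y y' (t i₀) hy' hne (by rw [← (hxt i₀).1]; exact hxy.symm)
    rw [G.graph.adj_comm, G.graph.adj_comm y'] at this
    by_cases hh : G.graph.Adj (s i₀) y ↔ G.graph.Adj (t i₀) y
    · exact ⟨y, Near.refl y, hh⟩
    · exact ⟨y', hy', by tauto⟩
  refine ⟨y, w, Near.refl y, hw, fun i => ?_⟩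
  by_cases hi : i₀ = i
  · subst hi
    exact hwi
  · have h1 := h _ _ y ((hxs i₀).symm.trans hcl (hxs i)) (hs.ne hi) (by rwa [← (hxs i₀).1])
    have h2 := h _ _ w ((hxt i₀).symm.trans hcl (hxt i)) (ht.ne hi)
      (by rwa [← (hxt i₀).1, ← hw.1])
    tauto

theorem Complementary.not_hasThreeCross (h : G.Complementary) : ¬ G.HasThreeCross := by
  rintro ⟨x, x', y, y', hx, hy, hxy, h1, h2, h3, h4⟩
  exact (h x x' y hx (by rintro rfl; exact h4 h2) hxy).1 h1 h3

/-- Over vertices in distinct cliques of one colour, all adjacency types are realized: flip those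
vertices whose adjacency to some given vertex is wrong to the other vertex of their clique. -/
theorem Complementary.exists_type (h : G.Complementary) (hG : G.Ultrahomogeneous)
    (hcl : ∀ c, G.IsCliqueUnion c)
    (hpair : ∀ c, ∃ a b, G.color a = c ∧ G.Near a b ∧ a ≠ b) {ι : Type*} [Finite ι]
    {y : ι → V} {c c' : Color} (hcc : c ≠ c') (hyc : ∀ i, G.color (y i) = c)
    (hy : ∀ i j, i ≠ j → ¬ G.Near (y i) (y j)) (P : ι → Prop) :
    ∃ x, G.color x = c' ∧ ∀ i, G.graph.Adj (y i) x ↔ P i := by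
  classical
  obtain ⟨x₀, -, hx₀, -⟩ := hpair c'
  choose p hp hpne using hG.exists_near_ne hpair
  let y' : ι → V := fun i => if (G.graph.Adj (y i) x₀ ↔ P i) then y i else p (y i)
  have near : ∀ i, G.Near (y i) (y' i) := by
    intro i
    by_cases hi : G.graph.Adj (y i) x₀ ↔ P i
    · simp only [y', hi, if_true]
      exact Near.refl _
    · simp only [y', hi, if_false]
      exact hp _
  have adj : ∀ i, G.graph.Adj (y' i) x₀ ↔ P i := by
    intro i
    by_cases hi : G.graph.Adj (y i) x₀ ↔ P i
    · simp only [y', hi, if_true]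
    · simp only [y', hi, if_false]
      have := h _ _ x₀ (hp (y i)) (hpne _) (by rwa [hyc, hx₀])
      tauto
  have hy' : ∀ i j, i ≠ j → ¬ G.Near (y' i) (y' j) := fun i j hij hn =>
    hy i j hij (((near i).trans hcl hn).trans hcl (near j).symm)
  have hy'c : ∀ i, G.color (y' i) = c := fun i => (near i).1.symm.trans (hyc i)
  have ne_of : ∀ {y : ι → V}, (∀ i j, i ≠ j → ¬ G.Near (y i) (y j)) → ∀ i j, y i = y j ↔ i = j :=
    fun hy i j => ⟨fun e => by_contra fun hij => hy i j hij (e ▸ Near.refl _), fun e => by rw [e]⟩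
  have nadj_of : ∀ {y : ι → V}, (∀ i, G.color (y i) = c) → (∀ i j, i ≠ j → ¬ G.Near (y i) (y j)) →
      ∀ i j, ¬ G.graph.Adj (y i) (y j) :=
    fun hyc hy i j ha => hy i j (by rintro rfl; exact ha.ne rfl)
      ⟨(hyc i).trans (hyc j).symm, Or.inr ha⟩
  obtain ⟨φ, hφ⟩ := hG.exists_iso y' y (fun i => (hy'c i).trans (hyc i).symm)
    (fun i j => by rw [ne_of hy, ne_of hy'])
    (fun i j => iff_of_false (nadj_of hy'c hy' i j) (nadj_of hyc hy i j))
  refine ⟨φ.toIso x₀, (φ.map_color _).trans hx₀, fun i => ?_⟩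
  rw [← hφ, φ.adj_iff, adj]

/-- By finiteness of the cliques, some colour class has infinitely many of them. -/
theorem Complementary.exists_sequence [Infinite V] (h : G.Complementary)
    (hcl : ∀ c, G.IsCliqueUnion c) (hne : ∀ c, (G.colorClass c).Nonempty) :
    ∃ (c c' : Color) (y : ℕ → V), c ≠ c' ∧ (∀ i, G.color (y i) = c) ∧
      ∀ i j, i ≠ j → ¬ G.Near (y i) (y j) := by
  obtain ⟨c, c', hcc, hc⟩ : ∃ c c', c ≠ c' ∧ (G.colorClass c).Infinite := by
    by_contra hcon
    push Not at hcon
    have h1 := hcon Color.red Color.blue (by simp)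
    have h2 := hcon Color.blue Color.red (by simp)
    refine Set.infinite_univ (α := V) ((h1.union h2).subset fun v _ => ?_)
    cases hv : G.color v
    · exact Or.inl hv
    · exact Or.inr hv
  have hmem := h.memClassF22 hcl hne
  have hfin : ∀ v, {z | G.Near v z}.Finite := by
    intro v
    have : {z | G.Near v z} ⊆ insert v {z | G.Near v z ∧ v ≠ z} := by
      intro z hz
      by_cases hvz : v = z
      · exact Or.inl hvz.symm
      · exact Or.inr ⟨hz, hvz⟩
    refine Set.Finite.subset (Set.Finite.insert _ (Set.Subsingleton.finite ?_)) this
    rintro a ⟨ha, hva⟩ b ⟨hb, hvb⟩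
    exact hmem.no_triangle ha hb hva hvb
  obtain ⟨y, hy, hyr⟩ := exists_seq_of_forall_finset_exists (fun v => G.color v = c)
    (fun v w => ¬ G.Near v w) (by
      intro s hs
      obtain ⟨z, hz, hzs⟩ := (hc.sdiff (s.finite_toSet.biUnion fun v _ => hfin v)).nonempty
      exact ⟨z, hz, fun v hv hvz => hzs (Set.mem_biUnion hv hvz)⟩)
  refine ⟨c, c', y, hcc, hy, fun i j hij hn => ?_⟩
  rcases lt_or_gt_of_ne hij with hlt | hlt
  · exact hyr i j hlt hn
  · exact hyr j i hlt hn.symm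

/-- Every finite graph of the class embeds: representatives of its cliques of the colour `c`
are sent to prescribed vertices in distinct cliques, those of the other colour are
found by their types, and the remaining vertices are sent to the other vertices of the cliques. -/
theorem Complementary.realizes [Infinite V] (h : G.Complementary) (hG : G.Ultrahomogeneous)
    (hcl : ∀ c, G.IsCliqueUnion c)
    (hpair : ∀ c, ∃ a b, G.color a = c ∧ G.Near a b ∧ a ≠ b) {n : ℕ}
    (H : TwoColoredGraph (Fin n)) (hH : H.MemClassF22) : G.Realizes H := by
  classical
  have hne : ∀ c, (G.colorClass c).Nonempty := by
    intro c
    obtain ⟨a, -, ha, -⟩ := hpair c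
    exact ⟨a, ha⟩
  obtain ⟨c, c', y, hcc, hyc, hy⟩ := h.exists_sequence hcl hne
  have hHc := hH.complementary
  -- The extra vertices `y (n + i)` and `y (2 * n)` ensure that the vertices realizing the types
  -- lie in distinct cliques.
  have hX : ∀ v : Fin n, ∃ x, G.color x = c' ∧ ∀ i : Fin (2 * n + 1),
      G.graph.Adj (y i) x ↔ ((∃ hi : i.1 < n, H.graph.Adj ⟨i, hi⟩ v) ∨ i.1 = n + v) := fun v =>
    h.exists_type hG hcl hpair hcc (fun i : Fin (2 * n + 1) => hyc i)
      (fun i j hij => hy i j fun h => hij (Fin.ext h)) _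
  choose X hXc hXa using hX
  have hXnear : ∀ v w, G.Near (X v) (X w) → v = w := by
    intro v w hvw
    by_contra hne
    have hvw' : X v ≠ X w := by
      intro heq
      have h1 := hXa v ⟨n + v, by omega⟩
      have h2 := hXa w ⟨n + v, by omega⟩
      rw [heq, h2] at h1
      have : (v : ℕ) ≠ w := fun h => hne (Fin.ext h)
      simp [this] at h1
    have h1 := hXa v ⟨2 * n, by omega⟩
    have h2 := hXa w ⟨2 * n, by omega⟩
    have h3 := h _ _ (y (2 * n)) hvw hvw' (by rw [hXc, hyc]; exact hcc.symm)
    have e1 : ¬ 2 * n = n + v := by omega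
    have e2 : ¬ 2 * n = n + w := by omega
    have e3 : ¬ 2 * n < n := by omega
    simp only [e1, e2, e3, IsEmpty.exists_iff, or_false, iff_false] at h1 h2
    exact h1 (h3.2 fun h => h2 h.symm).symm
  let sd : Setoid (Fin n) := ⟨H.Near, Near.refl, Near.symm, fun h h' => Near.trans hH.1 h h'⟩
  let rep : Fin n → Fin n := fun v => (Quotient.mk sd v).out
  have rep_near : ∀ v, H.Near (rep v) v := fun v => @Quotient.mk_out _ sd v
  have rep_eq : ∀ {v w}, H.Near v w → rep v = rep w := fun h =>
    congrArg Quotient.out (Quotient.sound h)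
  let Z : Fin n → V := fun v => if H.color v = c then y v else X v
  have Zpos : ∀ v, H.color v = c → Z v = y v := fun v hv => if_pos hv
  have Zneg : ∀ v, H.color v ≠ c → Z v = X v := fun v hv => if_neg hv
  have hZc : ∀ v, G.color (Z v) = H.color v := by
    intro v
    by_cases hv : H.color v = c
    · rw [Zpos v hv, hyc, hv]
    · rw [Zneg v hv, hXc, (color_ne_iff hcc).1 hv]
  have hZnear : ∀ v w, G.Near (Z v) (Z w) → v = w := by
    intro v w hvw
    have hcol := hvw.1
    rw [hZc, hZc] at hcol
    by_cases hv : H.color v = c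
    · rw [Zpos v hv, Zpos w (hcol ▸ hv)] at hvw
      by_contra hne
      exact hy v w (fun h => hne (Fin.ext h)) hvw
    · rw [Zneg v hv, Zneg w (hcol ▸ hv)] at hvw
      exact hXnear v w hvw
  have hZadj' : ∀ v w, H.color v = c → H.color w ≠ c →
      (G.graph.Adj (Z v) (Z w) ↔ H.graph.Adj v w) := by
    intro v w hv hw
    rw [Zpos v hv, Zneg w hw, hXa w ⟨v, by omega⟩]
    have : ¬ (v : ℕ) = n + w := by omega
    simp [this]
  have hZadj : ∀ v w, H.color v ≠ H.color w → (G.graph.Adj (Z v) (Z w) ↔ H.graph.Adj v w) := by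
    intro v w hvw
    by_cases hv : H.color v = c
    · exact hZadj' v w hv (hv ▸ hvw.symm)
    · have hw : H.color w = c := by
        have hv' := (color_ne_iff hcc).1 hv
        exact (color_ne_iff hcc.symm).1 (hv' ▸ hvw.symm)
      rw [G.graph.adj_comm, hZadj' w v hw hv, H.graph.adj_comm]
  choose p hp hpne using hG.exists_near_ne hpair
  let f : Fin n → V := fun v => if rep v = v then Z v else p (Z (rep v))
  have fpos : ∀ v, rep v = v → f v = Z v := fun v hv => if_pos hv
  have fneg : ∀ v, rep v ≠ v → f v = p (Z (rep v)) := fun v hv => if_neg hv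
  have hfnear : ∀ v, G.Near (Z (rep v)) (f v) := by
    intro v
    by_cases hv : rep v = v
    · rw [fpos v hv, hv]
      exact Near.refl _
    · rw [fneg v hv]
      exact hp _
  have hfc : ∀ v, G.color (f v) = H.color v := fun v => by
    rw [← (hfnear v).1, hZc, (rep_near v).1]
  have hnear : ∀ v w, G.Near (f v) (f w) → H.Near v w := by
    intro v w hvw
    have h1 := hZnear _ _ (((hfnear v).trans hcl hvw).trans hcl (hfnear w).symm)
    exact (rep_near v).symm.trans hH.1 (h1 ▸ rep_near w)
  have hsame : ∀ v w, v ≠ w → H.Near v w → G.graph.Adj (f v) (f w) := by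
    intro v w hvw hn
    have hrep := rep_eq hn
    by_cases hv : rep v = v
    · have hw : rep w ≠ w := fun hw => hvw (hv.symm.trans (hrep.trans hw))
      rw [fpos v hv, fneg w hw, ← hrep, hv]
      exact (hp _).adj (hpne _)
    · have hw : rep w = w := by
        by_contra hw
        exact hvw (hH.no_triangle (rep_near v) ((rep_near v).trans hH.1 hn) hv (hrep ▸ hw))
      rw [fneg v hv, fpos w hw, hrep, hw]
      exact ((hp _).adj (hpne _)).symm
  -- Passing from `rep v` to `v` either changes the cross adjacencies in both graphs or in neither.
  have hflip : ∀ v w, H.color v ≠ H.color w → ∀ u, G.color u = H.color w →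
      ((G.graph.Adj (f v) u ↔ G.graph.Adj (Z (rep v)) u) ↔
        (H.graph.Adj v w ↔ H.graph.Adj (rep v) w)) := by
    intro v w hvw u hu
    by_cases hv : rep v = v
    · rw [fpos v hv, hv]
      simp
    · have h1 := hHc _ _ w (rep_near v) hv (by rwa [(rep_near v).1])
      have h2 := h _ _ u (hp (Z (rep v))) (hpne _) (by rwa [hZc, (rep_near v).1, hu])
      rw [fneg v hv]
      tauto
  have hcross : ∀ v w, H.color v ≠ H.color w →
      (G.graph.Adj (f v) (f w) ↔ H.graph.Adj v w) := by
    intro v w hvw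
    have h1 := hflip v w hvw (f w) (hfc w)
    have h2 := hflip w (rep v) (by rw [(rep_near v).1]; exact hvw.symm) (Z (rep v)) (hZc _)
    have h3 := hZadj (rep v) (rep w) (by rwa [(rep_near v).1, (rep_near w).1])
    rw [G.graph.adj_comm (f w), G.graph.adj_comm (Z (rep w)), H.graph.adj_comm w,
      H.graph.adj_comm (rep w)] at h2
    tauto
  refine realizes_iff.2 ⟨f, fun v w hvw => ?_, hfc, fun v w => ?_⟩
  · by_contra hne
    exact (hsame v w hne (hnear v w (hvw ▸ Near.refl _))).ne hvw
  · by_cases hvw : H.color v = H.color w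
    · constructor
      · intro ha
        exact (hnear v w ⟨by rw [hfc, hfc, hvw], Or.inr ha⟩).adj (by rintro rfl; exact ha.ne rfl)
      · intro ha
        exact hsame v w ha.ne ⟨hvw, Or.inr ha⟩
    · exact hcross v w hvw

theorem Complementary.isF22 [Countable V] [Infinite V] (h : G.Complementary)
    (hG : G.Ultrahomogeneous) (hcl : ∀ c, G.IsCliqueUnion c)
    (hpair : ∀ c, ∃ a b, G.color a = c ∧ G.Near a b ∧ a ≠ b) : G.IsF22 := by
  refine ⟨inferInstance, hG, fun n H => ⟨fun hH => ?_, h.realizes hG hcl hpair H⟩⟩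
  refine (h.memClassF22 hcl fun c => ?_).of_realizes hH
  obtain ⟨a, -, ha, -⟩ := hpair c
  exact ⟨a, ha⟩

/-! ### The dichotomy -/

/-- If one colour class is independent, some vertex of it splits a clique of the other colour, and
together with this clique it does not induce an ultrahomogeneous graph. -/
theorem Ultrahomogeneous.not_piecewise [Countable V] (hG : G.Ultrahomogeneous)
    (hcl : ∀ c, G.IsCliqueUnion c) (hblow : ¬ G.IsBlowUp) (hbip : ¬ G.graph.IsBipartite)
    {c : Color} (hc : ∀ a b, G.color a = c → G.Near a b → a = b) :
    ¬ G.PiecewiseUltrahomogeneous := by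
  classical
  intro hP
  obtain ⟨a, b, hac, hab, hne⟩ : ∃ a b, G.color a ≠ c ∧ G.Near a b ∧ a ≠ b := by
    by_contra hcon
    push Not at hcon
    refine hbip ⟨SimpleGraph.Coloring.mk (fun v => if G.color v = Color.red then 0 else 1) ?_⟩
    intro v w hvw heq
    have hcol : G.color v = G.color w := by
      cases hv : G.color v <;> cases hw : G.color w <;> simp [hv, hw] at heq ⊢
    have hn : G.Near v w := ⟨hcol, Or.inr hvw⟩
    by_cases hv : G.color v = c
    · exact hvw.ne (hc v w hv hn)
    · exact hvw.ne (hcon v w hv hn)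
  obtain ⟨x, y, y', hx, hy, hyy, h1, h2⟩ := hG.exists_split hcl hblow hab hne
  have hxc : G.color x = c := by
    by_contra h
    have := (color_ne_iff hac).1 hx
    cases hh : G.color a <;> cases hx' : G.color x <;> cases hc' : c <;> simp_all
  have hxy : G.color y ≠ G.color x := by
    rw [hy, hxc]
    exact hac
  obtain ⟨v, hv, e, -⟩ := hP.exists_perm hcl hxy (Near.refl y) (Near.refl y) hyy hyy
    (by simp) (Near.refl x)
  rw [← hc x v hxc hv] at e
  exact h2 (e.1 h1.symm).symm

end TwoColoredGraph

theorem theoremA {V : Type*} [Countable V] [Infinite V] (G : TwoColoredGraph V)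
    (huh : G.Ultrahomogeneous)
    (hcliques : ∀ c : Color, G.IsCliqueUnion c)
    (hbip : ¬ G.graph.IsBipartite)
    (hblow : ¬ G.IsBlowUp)
    (hclass : ¬ ∀ c : Color, G.graph.IsClique (G.colorClass c)) :
    (¬ G.IsF22 →
      (G.PiecewiseUltrahomogeneous ↔
        G.Realizes TwoColoredGraph.diamond ∧
          G.Realizes TwoColoredGraph.diamond.crossCompl)) ∧
    (G.IsF22 →
      G.PiecewiseUltrahomogeneous ∧
        ¬ G.Realizes TwoColoredGraph.diamond ∧
          ¬ G.Realizes TwoColoredGraph.diamond.crossCompl) := by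
  rw [TwoColoredGraph.realizes_crossCompl_iff, TwoColoredGraph.realizes_diamond_iff,
    TwoColoredGraph.realizes_diamond_iff]
  refine ⟨fun hF => ?_, fun hF => ?_⟩
  · by_cases hpair : ∀ c, ∃ a b, G.color a = c ∧ G.Near a b ∧ a ≠ b
    · refine ⟨fun hP => ?_, fun ⟨h, h'⟩ =>
        (huh.allTypes hcliques h h').piecewise huh hcliques hpair⟩
      have hS := huh.splits hcliques hblow hpair
      -- Two vertices of one colour in different cliques, and a vertex of the other colour.
      obtain ⟨x, z, y, hxz, hxy, hnear⟩ : ∃ x z y, G.color x = G.color z ∧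
          G.color x ≠ G.color y ∧ ¬ G.Near x z := by
        by_contra hcon
        push Not at hcon
        refine hclass fun c x hx z hz hne => ?_
        have hx : G.color x = c := hx
        have hz : G.color z = c := hz
        obtain ⟨y, hy⟩ : ∃ y, G.color x ≠ G.color y := by
          obtain ⟨r, -, hr, -⟩ := hpair Color.red
          obtain ⟨b, -, hb, -⟩ := hpair Color.blue
          cases hh : G.color x
          · exact ⟨b, by simp [hb]⟩
          · exact ⟨r, by simp [hr]⟩
        exact (hcon x z y (hx.trans hz.symm) hy).adj hne
      by_cases h : G.HasThreeCross <;> by_cases h' : G.crossCompl.HasThreeCross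
      · exact ⟨h, h'⟩
      · refine absurd (huh.crossCompl.near_of_not_hasThreeCross
          (TwoColoredGraph.crossCompl_isCliqueUnion hcliques) hS.crossCompl h' ?_ hxz hxy)
          fun hn => hnear (TwoColoredGraph.crossCompl_near.1 hn)
        rwa [TwoColoredGraph.crossCompl_crossCompl]
      · exact absurd (huh.near_of_not_hasThreeCross hcliques hS h h' hxz hxy) hnear
      · have hC : G.Complementary := fun x x' y hx hne hxy =>
          hP.adj_iff_not_adj hcliques hS h h' hx hne hxy
        exact absurd (hC.isF22 huh hcliques hpair) hF
    · push Not at hpair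
      obtain ⟨c, hc⟩ := hpair
      refine iff_of_false (huh.not_piecewise hcliques hblow hbip hc) ?_
      rintro ⟨h, -⟩
      obtain ⟨c', hcc'⟩ : ∃ c', c ≠ c' := by
        cases c
        exacts [⟨Color.blue, by simp⟩, ⟨Color.red, by simp⟩]
      obtain ⟨x, x', y, y', hx, hy, hxc, hyc, h1, h2, h3, h4⟩ := h.exists_color hcc'
      exact h4 (hc x x' hxc hx ▸ h2)
  · have hC := (hF.memClassF22 hcliques).complementary
    exact ⟨hC.piecewise huh hcliques hF.exists_pair, hC.not_hasThreeCross,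
      hC.crossCompl.not_hasThreeCross⟩
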